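/- **Theorem (Convergence for noncritical formulas).** *Setting.* Let $\sigma$ be a finite relational signature all of whose relation symbols have positive arity. *Conditional probability logic* $CPL(\sigma)$ is the closure of the atomic formulas ($\top$, $x=y$, $R(\bar x)$) under $\neg,\wedge,\vee,\to,\leftrightarrow,\exists$ and under the two constructions $$\big(r+\|\varphi\mid\psi\|_{\bar y}\ge\|\theta\mid\tau\|_{\bar y}\big),\qquad \big(\|\varphi\mid\psi\|_{\bar y}\ge\|\theta\mid\tau\|_{\bar y}+r\big)\qquad (r\in\mathbb R_{\ge0}),$$ which bind the distinct variables $\bar y$. In a finite structure, $\|\varphi\mid\psi\|_{\bar y}$ is the proportion of tuples $\bar y$ satisfying $\varphi$ among those satisfying $\psi$; such a formula is false if $\psi$ or $\tau$ is satisfied by no $\bar y$. The quantifier rank $\mathrm{qr}$ is defined as usual, $\exists$ adding $1$ and the two constructions adding $|\bar y|$ to the maximum rank of their parts. A *lifted Bayesian network* $\mathfrak G$ for $\sigma$ consists of a directed acyclic graph on $\sigma$ and, for each $R\in\sigma$, finitely many *aggregation formulas* $\chi_{R,1}(\bar x),\dots,\chi_{R,\nu_R}(\bar x)\in CPL(\mathrm{par}(R))$,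 $\nu_R \ge 1$, with $|\bar x|$ the arity of $R$, such that in every nonempty finite structure each $\bar a$ satisfies exactly one of them, together with numbers $\mu(R\mid\chi_{R,i})\in[0,1]$. For $n\ge1$ it induces the probability distribution $\mathbb P_n$ on the set of $\sigma$-structures $\mathcal A$ with domain $[n]=\{1,\dots,n\}$, $$\mathbb P_n(\mathcal A)=\prod_{R\in\sigma}\prod_{i=1}^{\nu_R}\prod_{\bar a:\,\mathcal A\models\chi_{R,i}(\bar a)}\lambda(\mathcal A,R,i,\bar a),$$ where $\lambda=\mu(R\mid\chi_{R,i})$ if $\mathcal A\models R(\bar a)$ and $\lambda=1-\mu(R\mid\chi_{R,i})$ otherwise. Write $\mathbb P_n(\varphi(\bar a))$ for $\mathbb P_n(\{\mathcal A:\mathcal A\models\varphi(\bar a)\})$. *Critical numbers.* Let $S\subseteq\sigma$ be closed under parents. For a complete atomic $S$-type $p(\bar x)$ let $\mathsf P(p)$ be the limit of $\mathbb P_n(p(\bar a))$ as $n\to\infty$, uniformly over the tuples $\bar a$ in $[n]$ having exactly the equalities among their entries prescribed by $p$; put $\mathsf P(p\mid q)=\mathsf P(p)/\mathsf P(q)$.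 For $m \in \mathbb N$, a real number $\alpha$ is *$m$-critical for $S$* if (a) $\alpha=\sum_{i\le l'}\mathsf P(p_i\mid q)\big/\sum_{i\le l}\mathsf P(p_i\mid q)$ for some complete atomic $S$-type $q(\bar x)$ and some distinct complete atomic $S$-types $p_1(\bar x,\bar y),\dots,p_l(\bar x,\bar y)\supseteq q$ with $|\bar x\bar y|\le m$ and $1\le l'\le l$ (the limits involved existing and the denominators being positive; $\bar x$ or $\bar y$ may be empty); or (b) $\alpha=l'/l$ for integers $0\le l'\le l$, $1\le l\le\max(1,N)$, where $N$ is the number of pairs $(p(x_1,\dots,x_{m'}),q(x_1,\dots,x_d))$ of complete atomic $S$-types with $d<m'\le m$, $q\subseteq p$, such that $p$ has dimension $0$ in the variables $(x_d,\dots,x_{m'})$, i.e. $p$ identifies each of them with one of $x_1,\dots,x_{d-1}$. A formula $\varphi(\bar x)$ is *noncritical for $S$* if, with $l=|\bar x|+\mathrm{qr}(\varphi)$, no number $r$ occurring in a subformula $(r+\|\cdot\mid\cdot\|_{\bar y}\ge\|\cdot\mid\cdot\|_{\bar y})$ or $(\|\cdot\mid\cdot\|_{\bar y}\ge\|\cdot\mid\cdot\|_{\bar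 y}+r)$ of $\varphi$ is a difference of two numbers that are $l$-critical for $S$. *Noncritical* and *critical* without further qualification mean for $S=\sigma$, and (for numbers) $l$-critical for some positive integer $l$. *Statement.* Suppose that every aggregation formula $\chi_{R,i}$ of $\mathfrak G$ is noncritical for the set of proper ancestors of $R$ (the subnetwork on which $\chi_{R,i}$ is evaluated). Then: 1. For every noncritical $\varphi(\bar x)\in CPL(\sigma)$ there are $c>0$ and, for every equivalence relation $E$ on the set of positions of $\bar x$, a critical number $d_E\in[0,1]$, such that for every $m\ge1$ and every $\bar a\in[m]^{|\bar x|}$, if $E$ is the relation $\{(i,j):a_i=a_j\}$, then $$\big|\mathbb P_n(\varphi(\bar a))-d_E\big|\le e^{-cn}\quad\text{for all sufficiently large } n\ge m.$$ In particular, $d_E$ is the same for all tuples $\bar a$ with pairwise distinct entries. 2. If $\varphi$ is a noncritical sentence, then $\mathbb P_n(\varphi)$ converges to $0$ or to $1$. -/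

import Mathlib

open Filter Topology
open scoped NNReal

universe u v

/-! ### Finite relational structures and conditional probability logic

A finite relational signature is a finite type `σ` of relation symbols with an arity function `ar`. -/

/-- A structure with domain `α` for the signature `(σ, ar)`. -/
abbrev RelStr {σ : Type u} (ar : σ → ℕ) (α : Type v) : Type (max u v) :=
  (R : σ) → (Fin (ar R) → α) → Prop

/-- Formulas `φ(x₁, …, x_k)` of conditional probability logic over `(σ, ar)`, up to renaming of bound
variables. The free variables are indexed by `Fin k`; a quantifier binds the last variables. -/
inductive CPL {σ : Type u} (ar : σ → ℕ) : ℕ → Type u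
  | top {k : ℕ} : CPL ar k
  | eq {k : ℕ} (i j : Fin k) : CPL ar k
  | rel {k : ℕ} (R : σ) (t : Fin (ar R) → Fin k) : CPL ar k
  | not {k : ℕ} (φ : CPL ar k) : CPL ar k
  | and {k : ℕ} (φ ψ : CPL ar k) : CPL ar k
  | or {k : ℕ} (φ ψ : CPL ar k) : CPL ar k
  | imp {k : ℕ} (φ ψ : CPL ar k) : CPL ar k
  | iff {k : ℕ} (φ ψ : CPL ar k) : CPL ar k
  | ex {k : ℕ} (φ : CPL ar (k + 1)) : CPL ar k
  /-- `r + ‖φ | ψ‖_y ≥ ‖θ | τ‖_y`, where `y` is a sequence of `e` variables. -/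
  | probLeft {k : ℕ} (e : ℕ) (r : ℝ≥0) (φ ψ θ τ : CPL ar (k + e)) : CPL ar k
  /-- `‖φ | ψ‖_y ≥ ‖θ | τ‖_y + r`, where `y` is a sequence of `e` variables. -/
  | probRight {k : ℕ} (e : ℕ) (r : ℝ≥0) (φ ψ θ τ : CPL ar (k + e)) : CPL ar k

/-- The proportion `|X ∩ Y| / |Y|`; it is used only for nonempty finite `Y`. -/
noncomputable def proportion {β : Type v} (X Y : Set β) : ℝ :=
  ((X ∩ Y).ncard : ℝ) / (Y.ncard : ℝ)

namespace CPL

variable {σ : Type u} {ar : σ → ℕ}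

/-- Satisfaction `A ⊨ φ(a)`, for structures with a finite domain. -/
def Sat {α : Type v} (A : RelStr ar α) : {k : ℕ} → CPL ar k → (Fin k → α) → Prop
  | _, top, _ => True
  | _, eq i j, a => a i = a j
  | _, rel R t, a => A R (fun s => a (t s))
  | _, not φ, a => ¬ Sat A φ a
  | _, and φ ψ, a => Sat A φ a ∧ Sat A ψ a
  | _, or φ ψ, a => Sat A φ a ∨ Sat A ψ a
  | _, imp φ ψ, a => Sat A φ a → Sat A ψ a
  | _, iff φ ψ, a => (Sat A φ a ↔ Sat A ψ a)
  | _, ex φ, a => ∃ b : α, Sat A φ (Fin.snoc (α := fun _ => α) a b)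
  | _, probLeft e r φ ψ θ τ, a =>
      {b : Fin e → α | Sat A ψ (Fin.append a b)}.Nonempty ∧
      {b : Fin e → α | Sat A τ (Fin.append a b)}.Nonempty ∧
      (r : ℝ) + proportion {b : Fin e → α | Sat A φ (Fin.append a b)}
          {b : Fin e → α | Sat A ψ (Fin.append a b)} ≥
        proportion {b : Fin e → α | Sat A θ (Fin.append a b)}
          {b : Fin e → α | Sat A τ (Fin.append a b)}
  | _, probRight e r φ ψ θ τ, a =>
      {b : Fin e → α | Sat A ψ (Fin.append a b)}.Nonempty ∧
      {b : Fin e → α | Sat A τ (Fin.append a b)}.Nonempty ∧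
      proportion {b : Fin e → α | Sat A φ (Fin.append a b)}
          {b : Fin e → α | Sat A ψ (Fin.append a b)} ≥
        proportion {b : Fin e → α | Sat A θ (Fin.append a b)}
          {b : Fin e → α | Sat A τ (Fin.append a b)} + (r : ℝ)

/-- Quantifier rank. -/
def qr : {k : ℕ} → CPL ar k → ℕ
  | _, top => 0
  | _, eq _ _ => 0
  | _, rel _ _ => 0
  | _, not φ => qr φ
  | _, and φ ψ => max (qr φ) (qr ψ)
  | _, or φ ψ => max (qr φ) (qr ψ)
  | _, imp φ ψ => max (qr φ) (qr ψ)
  | _, iff φ ψ => max (qr φ) (qr ψ)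
  | _, ex φ => qr φ + 1
  | _, probLeft e _ φ ψ θ τ => max (max (qr φ) (qr ψ)) (max (qr θ) (qr τ)) + e
  | _, probRight e _ φ ψ θ τ => max (max (qr φ) (qr ψ)) (max (qr θ) (qr τ)) + e

/-- The relation symbols that occur in a formula. -/
def symbols : {k : ℕ} → CPL ar k → Set σ
  | _, top => ∅
  | _, eq _ _ => ∅
  | _, rel R _ => {R}
  | _, not φ => symbols φ
  | _, and φ ψ => symbols φ ∪ symbols ψ
  | _, or φ ψ => symbols φ ∪ symbols ψ
  | _, imp φ ψ => symbols φ ∪ symbols ψ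
  | _, iff φ ψ => symbols φ ∪ symbols ψ
  | _, ex φ => symbols φ
  | _, probLeft _ _ φ ψ θ τ => symbols φ ∪ symbols ψ ∪ symbols θ ∪ symbols τ
  | _, probRight _ _ φ ψ θ τ => symbols φ ∪ symbols ψ ∪ symbols θ ∪ symbols τ

/-- The numbers `r` that occur in subformulas `r + ‖φ | ψ‖_y ≥ ‖θ | τ‖_y` or
`‖φ | ψ‖_y ≥ ‖θ | τ‖_y + r` of a formula. -/
def thresholds : {k : ℕ} → CPL ar k → Set ℝ
  | _, top => ∅
  | _, eq _ _ => ∅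
  | _, rel _ _ => ∅
  | _, not φ => thresholds φ
  | _, and φ ψ => thresholds φ ∪ thresholds ψ
  | _, or φ ψ => thresholds φ ∪ thresholds ψ
  | _, imp φ ψ => thresholds φ ∪ thresholds ψ
  | _, iff φ ψ => thresholds φ ∪ thresholds ψ
  | _, ex φ => thresholds φ
  | _, probLeft _ r φ ψ θ τ =>
      {(r : ℝ)} ∪ thresholds φ ∪ thresholds ψ ∪ thresholds θ ∪ thresholds τ
  | _, probRight _ r φ ψ θ τ =>
      {(r : ℝ)} ∪ thresholds φ ∪ thresholds ψ ∪ thresholds θ ∪ thresholds τ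

end CPL

/-! ### Complete atomic types -/

/-- A complete atomic type `p(x₁, …, x_k)` over the set `S` of relation symbols: which variables are
identified, and which atomic formulas hold. A complete set of literals is consistent exactly when the
identifications form an equivalence relation that the atomic formulas respect. -/
@[ext]
structure AtomicType {σ : Type u} (ar : σ → ℕ) (S : Set σ) (k : ℕ) where
  ident : Setoid (Fin k)
  holds : (R : S) → (Fin (ar R) → Fin k) → Prop
  congr : ∀ (R : S) (s t : Fin (ar R) → Fin k), (∀ i, ident (s i) (t i)) → (holds R s ↔ holds R t)

namespace AtomicType

variable {σ : Type u} {ar : σ → ℕ} {S : Set σ}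

/-- `A ⊨ p(a)`. -/
def Realizes {α : Type v} {k : ℕ} (p : AtomicType ar S k) (A : RelStr ar α) (a : Fin k → α) : Prop :=
  Setoid.ker a = p.ident ∧
    ∀ (R : S) (t : Fin (ar R) → Fin k), p.holds R t ↔ A R (fun s => a (t s))

/-- The restriction of `p` to its first `d` variables; `q ⊆ p` means `p.restrict h = q`. -/
def restrict {d k : ℕ} (p : AtomicType ar S k) (h : d ≤ k) : AtomicType ar S d where
  ident := Setoid.comap (Fin.castLE h) p.ident
  holds := fun R t => p.holds R (fun s => Fin.castLE h (t s))
  congr := fun R _ _ hst => p.congr R _ _ hst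

/-- The dimension of `p` in the variables `y = (x_{j+1}, …, x_k)`: the number of elements in a realization
of `p` that are not the value of one of `x₁, …, x_j`. -/
noncomputable def dimAfter {k : ℕ} (p : AtomicType ar S k) (j : ℕ) : ℕ :=
  {c : Quotient p.ident | ∀ i : Fin k, i.val < j → c ≠ Quotient.mk p.ident i}.ncard

end AtomicType

/-! ### Lifted Bayesian networks -/

/-- A lifted Bayesian network for `(σ, ar)`: a directed acyclic graph on `σ` together with, for every `R`,
finitely many aggregation formulas over the parents of `R` that partition the `ar R`-tuples of every
(nonempty, finite) structure, and a probability for each of them. -/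
structure LiftedBayesNet {σ : Type u} (ar : σ → ℕ) where
  graph : Digraph σ
  acyclic : ∀ R, ¬ Relation.TransGen graph.Adj R R
  num : σ → ℕ
  num_pos : ∀ R, 0 < num R
  agg : (R : σ) → Fin (num R) → CPL ar (ar R)
  agg_parents : ∀ R i, (agg R i).symbols ⊆ {Q | graph.Adj Q R}
  agg_cover : ∀ R (n : ℕ), 0 < n → ∀ (A : RelStr ar (Fin n)) (a : Fin (ar R) → Fin n),
    ∃ i, (agg R i).Sat A a
  agg_disjoint : ∀ R (i j : Fin (num R)), i ≠ j → ∀ (n : ℕ), 0 < n →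
    ∀ (A : RelStr ar (Fin n)) (a : Fin (ar R) → Fin n), ¬ ((agg R i).Sat A a ∧ (agg R j).Sat A a)
  μ : (R : σ) → Fin (num R) → ℝ
  μ_mem : ∀ R i, 0 ≤ μ R i ∧ μ R i ≤ 1

namespace LiftedBayesNet

variable {σ : Type u} {ar : σ → ℕ}

/-- The set of proper ancestors of `R` in the graph. -/
def ancestors (G : LiftedBayesNet ar) (R : σ) : Set σ := {Q | Relation.TransGen G.graph.Adj Q R}

variable [Fintype σ]

open Classical in
/-- The probability of the structure `A` with domain `{1, …, n}` (represented by `Fin n`). This is the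
recursion over the levels of the graph, written out: for each `R` and each tuple `a`, the factor is `μ R i`
or `1 - μ R i`, where `χ_{R,i}` is the aggregation formula that `a` satisfies. Since `χ_{R,i}` mentions only
parents of `R`, it is evaluated in the already generated reduct. -/
noncomputable def weight (G : LiftedBayesNet ar) (n : ℕ) (A : RelStr ar (Fin n)) : ℝ :=
  ∏ R : σ, ∏ i : Fin (G.num R), ∏ a : Fin (ar R) → Fin n with (G.agg R i).Sat A a,
    if A R a then G.μ R i else 1 - G.μ R i

open Classical in
/-- The probability `P_n(X)` of a set `X` of structures with domain `{1, …, n}`. -/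
noncomputable def prob (G : LiftedBayesNet ar) (n : ℕ) (X : Set (RelStr ar (Fin n))) : ℝ :=
  ∑ A : RelStr ar (Fin n) with A ∈ X, G.weight n A

/-- `v` is the number `P(p)`: the limit of `P_n(p(a))`, uniformly in the tuples `a` that realize the
identity fragment of `p`. If `S` is closed under parents, then the event depends only on the reduct to `S`,
whose distribution is that of the subnetwork induced by `S`. -/
def IsTypeLimit (G : LiftedBayesNet ar) {S : Set σ} {k : ℕ} (p : AtomicType ar S k) (v : ℝ) : Prop :=
  ∀ ε > 0, ∃ N : ℕ, ∀ n ≥ N, ∀ a : Fin k → Fin n, Setoid.ker a = p.ident →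
    |G.prob n {A | p.Realizes A a} - v| ≤ ε

end LiftedBayesNet

/-- The number of pairs `(p(x₁, …, x_{m'}), q(x₁, …, x_d))` of complete atomic types over `S` with
`d < m' ≤ m`, `q ⊆ p`, and dimension `0` of `p` in the variables `(x_d, …, x_{m'})`. -/
noncomputable def zeroDimPairs {σ : Type u} (ar : σ → ℕ) (S : Set σ) (m : ℕ) : ℕ :=
  ∑ m' ∈ Finset.range (m + 1), ∑ d : Fin m',
    Nat.card {pq : AtomicType ar S m' × AtomicType ar S d //
      pq.1.restrict d.isLt.le = pq.2 ∧ pq.1.dimAfter (d.val - 1) = 0}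

namespace LiftedBayesNet

variable {σ : Type u} {ar : σ → ℕ} [Fintype σ]

/-- `α` is `m`-critical for the subnetwork induced by `S` (for the whole network if `S = Set.univ`).

In the first clause `U = {p₁, …, p_l}` and `T = {p₁, …, p_{l'}}` are sets of complete types `p(x, y)` that
extend `q(x)`, and `P(p | q) = P(p) / P(q)`; all quotients are required to be defined.
The `max 1` in the second clause makes `0` and `1` critical for every `m`. -/
def IsCritical (G : LiftedBayesNet ar) (S : Set σ) (m : ℕ) (α : ℝ) : Prop :=
  (∃ (d k : ℕ) (h : d ≤ k), k ≤ m ∧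
    ∃ (q : AtomicType ar S d) (Pq : ℝ) (T U : Finset (AtomicType ar S k)) (P : AtomicType ar S k → ℝ),
      G.IsTypeLimit q Pq ∧ 0 < Pq ∧ T.Nonempty ∧ T ⊆ U ∧
      (∀ p ∈ U, p.restrict h = q ∧ G.IsTypeLimit p (P p)) ∧
      0 < ∑ p ∈ U, P p / Pq ∧
      α = (∑ p ∈ T, P p / Pq) / (∑ p ∈ U, P p / Pq)) ∨
  (∃ l' l : ℕ, l' ≤ l ∧ 1 ≤ l ∧ l ≤ max 1 (zeroDimPairs ar S m) ∧ α = (l' : ℝ) / (l : ℝ))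

/-- `φ(x₁, …, x_k)` is noncritical for the subnetwork induced by `S`. -/
def Noncritical (G : LiftedBayesNet ar) (S : Set σ) {k : ℕ} (φ : CPL ar k) : Prop :=
  ∀ r ∈ φ.thresholds, ∀ α β : ℝ,
    G.IsCritical S (k + φ.qr) α → G.IsCritical S (k + φ.qr) β → r ≠ α - β

end LiftedBayesNet

/-! Regard the ground atoms `R(t)` as the nodes of a finite Bayesian network. The obstacle is that
aggregation formulas inspect the whole structure. Suppose instead that the conditional probability
of `R(t)` depends only on the atomic type of `t` over the ancestors of `R` (a `LocalNet`). Then the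
probability of `p(a)` is the same for all `n` and `a`. Moreover, given `q(a)`, the events `p(a, b)`
for different `b` outside `a` are independent with probability `P(p) / P(q)`, so the number of
one-point extensions of `a` is binomial. Chernoff's bound and a union bound over the polynomially
many tuples show that, outside an event of exponentially small probability, every realization of `q`
has `n P(p) / P(q)` such extensions up to `ε n` (`LocalNet.genericLimit`).

Adding the variables of a tuple one at a time, the number of tuples extending `a` to a realization
of `p` is asymptotically `n ^ d` times `P(p) / P(q)`. Hence, given `q`, every proportion converges
to a quotient of two sums over the types of dominant degree, which is a critical number. A threshold
formula compares two such limits up to `r`; if `r` is not a difference of critical numbers, the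
comparison is strict in the limit and therefore settled almost surely. By induction on formulas, a
noncritical formula is almost surely equivalent to a set of atomic types
(`GenericLimit.exists_types`).

Applied to the aggregation formulas themselves, this removes the obstacle: by induction on the
number of ancestors, each of them is replaced by a condition on types, which yields a local network
(`LiftedBayesNet.exists_localNet`). Networks whose conditional probabilities agree outside a bad
event differ in total variation by at most its probability (`IsNet.abs_netProb_sub_le`), so the
given network is exponentially close to the local one. The limit `d E` is the total probability of
the types with equality pattern `E` that imply the formula. For a sentence only one type exists,
since all arities are positive, and the limit is 0 or 1. -/

/-! ### Finite Bayesian networks with two-valued nodes -/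

section BayesNet

open Classical

variable {I : Type*}

/-- The probability that a proposition has the truth value `b` if it holds with probability `x`. -/
noncomputable def bernoulliFactor (x : ℝ) (b : Prop) : ℝ := if b then x else 1 - x

/-- The product of the conditional probabilities of the nodes in `J` at the outcome `ω`. -/
noncomputable def netWeight (f : I → (I → Prop) → ℝ) (J : Finset I) (ω : I → Prop) : ℝ :=
  ∏ i ∈ J, bernoulliFactor (f i ω) (ω i)

/-- The conditional probability of a node `i` depends only on the nodes in `dep i`, and these have
smaller rank. -/
structure IsNet (f : I → (I → Prop) → ℝ) (dep : I → Set I) (ρ : I → ℕ) : Prop where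
  dependsOn : ∀ i, DependsOn (f i) (dep i)
  rank_lt : ∀ i, ∀ j ∈ dep i, ρ j < ρ i

lemma DependsOn.update_eq {β : Type*} {H : (I → Prop) → β} {J : Set I} (hH : DependsOn H J) {j : I}
    (hj : j ∉ J) (ω : I → Prop) (b : Prop) : H (Function.update ω j b) = H ω :=
  hH fun _ hi => Function.update_of_ne (ne_of_mem_of_not_mem hi hj) _ _

variable {f g : I → (I → Prop) → ℝ} {dep dep' : I → Set I} {ρ ρ' : I → ℕ}

lemma netWeight_nonneg (h0 : ∀ i ω, 0 ≤ f i ω) (h1 : ∀ i ω, f i ω ≤ 1) (J : Finset I)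
    (ω : I → Prop) : 0 ≤ netWeight f J ω := by
  refine Finset.prod_nonneg fun i _ => ?_
  unfold bernoulliFactor
  split_ifs
  · exact h0 i ω
  · linarith [h1 i ω]

lemma IsNet.netWeight_update (hf : IsNet f dep ρ) {J : Finset I} (hJ : ∀ i ∈ J, dep i ⊆ J) {j : I}
    (hj : j ∉ J) (ω : I → Prop) (b : Prop) :
    netWeight f J (Function.update ω j b) = netWeight f J ω := by
  refine Finset.prod_congr rfl fun i hi => ?_
  rw [(hf.dependsOn i).update_eq (fun h => hj (hJ i hi h)),
    Function.update_of_ne (ne_of_mem_of_not_mem hi hj)]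

variable [Fintype I]

/-- Expectation in the network with conditional probabilities `f`. -/
noncomputable def netExp (f : I → (I → Prop) → ℝ) (H : (I → Prop) → ℝ) : ℝ :=
  ∑ ω, netWeight f Finset.univ ω * H ω

/-- Probability in the network with conditional probabilities `f`. -/
noncomputable def netProb (f : I → (I → Prop) → ℝ) (X : Set (I → Prop)) : ℝ :=
  netExp f (X.indicator 1)

/-- Flipping coordinate `j` is an involution that exchanges the factors `g ω` and `1 - g ω`, whose
sum is 1. Averaging over it sums out the node `j`. -/
lemma sum_mul_bernoulliFactor {G g : (I → Prop) → ℝ} {j : I}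
    (hG : ∀ ω b, G (Function.update ω j b) = G ω) (hg : ∀ ω b, g (Function.update ω j b) = g ω) :
    ∑ ω, G ω * bernoulliFactor (g ω) (ω j) = 1 / 2 * ∑ ω, G ω := by
  let flip : (I → Prop) → (I → Prop) := fun ω => Function.update ω j (¬ ω j)
  have hflip : Function.Involutive flip := fun ω => by
    funext i
    by_cases hi : i = j
    · subst hi; simp [flip]
    · simp [flip, hi]
  have h1 : ∑ ω, G ω * bernoulliFactor (g ω) (ω j)
      = ∑ ω, G ω * bernoulliFactor (g ω) (¬ ω j) := by
    rw [← Equiv.sum_comp (hflip.toPerm flip)]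
    refine Finset.sum_congr rfl fun ω _ => ?_
    simp [flip, hG, hg]
  have h2 : ∑ ω, G ω * bernoulliFactor (g ω) (ω j) + ∑ ω, G ω * bernoulliFactor (g ω) (¬ ω j)
      = ∑ ω, G ω := by
    rw [← Finset.sum_add_distrib]
    refine Finset.sum_congr rfl fun ω _ => ?_
    by_cases h : ω j <;> simp [bernoulliFactor, h] <;> ring
  linarith

/-- The nodes outside a set `J` that is closed under parents can be replaced by fair coins. -/
lemma IsNet.netExp_eq (hf : IsNet f dep ρ) {J : Finset I} (hJ : ∀ i ∈ J, dep i ⊆ J)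
    {H : (I → Prop) → ℝ} (hH : DependsOn H (J : Set I)) :
    netExp f H = (1 / 2) ^ (Jᶜ).card * ∑ ω, netWeight f J ω * H ω := by
  induction hn : (Jᶜ).card generalizing J with
  | zero =>
    have : J = Finset.univ := by simpa using hn
    simp [netExp, this]
  | succ n ih =>
    -- A node of least rank outside `J` has all its parents in `J`, so `insert j J` is again closed
    -- under parents, and `ω j` occurs only in the factor of `j` itself.
    obtain ⟨j, hj, hmin⟩ := Finset.exists_min_image Jᶜ ρ (Finset.card_pos.1 (by omega))
    have hjJ : j ∉ J := by simpa using hj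
    have hsub : dep j ⊆ J := fun i hi => by
      by_contra h
      have := hmin i (by simpa using h)
      have := hf.rank_lt j i hi
      omega
    have hc : ((insert j J)ᶜ).card = n := by
      rw [Finset.compl_insert, Finset.card_erase_of_mem hj]; omega
    rw [ih (J := insert j J) ?_ (fun x y h => hH fun i hi => h i (by simp_all)) hc]
    · have h1 : ∀ ω, netWeight f (insert j J) ω * H ω
          = (netWeight f J ω * H ω) * bernoulliFactor (f j ω) (ω j) := fun ω => by
        rw [netWeight, Finset.prod_insert hjJ, ← netWeight]; ring
      simp_rw [h1]
      rw [sum_mul_bernoulliFactor]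
      · ring
      · intro ω b
        rw [hf.netWeight_update hJ hjJ, hH.update_eq (by simpa using hjJ)]
      · intro ω b
        rw [(hf.dependsOn j).update_eq (fun h => hjJ (hsub h))]
    · intro i hi
      rcases Finset.mem_insert.1 hi with rfl | hi
      · exact hsub.trans (by simp)
      · exact (hJ i hi).trans (by simp)

/-- With `J` empty, all nodes become fair coins; in particular the weights sum to 1. -/
lemma IsNet.netExp_const (hf : IsNet f dep ρ) (c : ℝ) : netExp f (fun _ => c) = c := by
  rw [hf.netExp_eq (J := ∅) (by simp) (fun _ _ _ => rfl)]
  simp [netWeight]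

/-- Networks that agree on a set of nodes closed under parents induce the same distribution there. -/
lemma IsNet.netExp_congr (hf : IsNet f dep ρ) (hg : IsNet g dep' ρ') {J : Finset I}
    (hJ : ∀ i ∈ J, dep i ⊆ J) (hJ' : ∀ i ∈ J, dep' i ⊆ J) (hfg : ∀ i ∈ J, f i = g i)
    {H : (I → Prop) → ℝ} (hH : DependsOn H (J : Set I)) : netExp f H = netExp g H := by
  rw [hf.netExp_eq hJ hH, hg.netExp_eq hJ' hH]
  congr 1
  refine Finset.sum_congr rfl fun ω _ => ?_
  congr 1
  exact Finset.prod_congr rfl fun i hi => by rw [hfg i hi]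

/-- One step of the chain rule: given the nodes in `J`, a node whose parents lie in `J` is a coin
with its own conditional probability. -/
lemma IsNet.netExp_node (hf : IsNet f dep ρ) {J : Finset I} (hJ : ∀ i ∈ J, dep i ⊆ J) {i : I}
    (hi : i ∉ J) (hdep : dep i ⊆ J) {H : (I → Prop) → ℝ} (hH : DependsOn H (J : Set I)) (b : Prop) :
    netExp f (fun ω => H ω * if (ω i ↔ b) then 1 else 0)
      = netExp f (fun ω => H ω * bernoulliFactor (f i ω) b) := by
  have hJi : ∀ j ∈ insert i J, dep j ⊆ (insert i J : Finset I) := by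
    intro j hj
    rcases Finset.mem_insert.1 hj with rfl | hj
    · exact hdep.trans (by simp)
    · exact (hJ j hj).trans (by simp)
  have hc : (Jᶜ).card = ((insert i J)ᶜ).card + 1 := by
    rw [Finset.compl_insert, Finset.card_erase_of_mem (by simpa using hi)]
    have : 0 < (Jᶜ).card := Finset.card_pos.2 ⟨i, by simpa using hi⟩
    omega
  rw [hf.netExp_eq hJi (H := fun ω => H ω * if (ω i ↔ b) then 1 else 0),
    hf.netExp_eq hJ (H := fun ω => H ω * bernoulliFactor (f i ω) b), hc, pow_succ, mul_assoc]
  · congr 1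
    -- The indicator of `ω i ↔ b` is a Bernoulli factor with the degenerate probability 0 or 1, so
    -- summing out `i` produces the missing factor `1 / 2`.
    rw [← sum_mul_bernoulliFactor (j := i) (g := fun _ => if b then 1 else 0)]
    · refine Finset.sum_congr rfl fun ω _ => ?_
      rw [netWeight, Finset.prod_insert hi, ← netWeight]
      by_cases h : ω i <;> by_cases hb : b <;> simp [bernoulliFactor, h, hb] <;> ring
    · intro ω c
      rw [hf.netWeight_update hJ hi, hH.update_eq (by simpa using hi),
        (hf.dependsOn i).update_eq (fun h => hi (hdep h))]
    · intros; rfl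
  · intro x y h
    simp only [hH h, hf.dependsOn i (fun j hj => h j (hdep hj))]
  · intro x y h
    simp only [hH (fun j hj => h j (by simp_all)), h i (by simp)]

/-- The conditional probability that the nodes in `K` take the values prescribed by `π`. -/
lemma IsNet.netExp_pattern (hf : IsNet f dep ρ) {J C : Finset I} (hJ : ∀ i ∈ J, dep i ⊆ J)
    (π : I → Prop) {F : (I → Prop) → ℝ} (hF : DependsOn F (J : Set I)) (hCJ : C ⊆ J)
    (hFC : ∀ ω, F ω ≠ 0 → ∀ i ∈ C, ω i ↔ π i) {K : Finset I} (hKJ : Disjoint K J)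
    (hK : ∀ i ∈ K, dep i ⊆ (C : Set I) ∪ K) :
    netExp f (fun ω => F ω * if (∀ i ∈ K, (ω i ↔ π i)) then 1 else 0)
      = (∏ i ∈ K, bernoulliFactor (f i π) (π i)) * netExp f F := by
  induction hn : K.card generalizing K with
  | zero =>
    have : K = ∅ := by simpa using hn
    simp [this]
  | succ n ih =>
    -- No node of `K` depends on one of greatest rank, so it can be removed from `K` without
    -- spoiling the hypotheses.
    obtain ⟨j, hj, hmax⟩ := Finset.exists_max_image K ρ (Finset.card_pos.1 (by omega))
    set K' := K.erase j with hK'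
    have hKins : K = insert j K' := (Finset.insert_erase hj).symm
    have hjK' : j ∉ K' := by simp [hK']
    have hdep : ∀ i ∈ K, dep i ⊆ (C ∪ K' : Finset I) := by
      intro i hi x hx
      have h1 := hK i hi hx
      have h2 : x ≠ j := by
        rintro rfl
        have := hf.rank_lt i x hx
        have := hmax i hi
        omega
      simp only [Finset.coe_union, Set.mem_union, Finset.mem_coe, hKins, Finset.mem_insert] at h1 ⊢
      tauto
    have hKJ' : Disjoint K' J := hKJ.mono_left (Finset.erase_subset _ _)
    have hjJ : j ∉ J := Finset.disjoint_left.1 hKJ hj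
    have ih' := ih (K := K') hKJ'
      (fun i hi => Finset.coe_union C K' ▸ hdep i (Finset.mem_of_mem_erase hi))
      (by rw [hK', Finset.card_erase_of_mem hj]; omega)
    have hcl : ∀ i ∈ J ∪ K', dep i ⊆ (J ∪ K' : Finset I) := by
      intro i hi
      rcases Finset.mem_union.1 hi with hi | hi
      · exact (hJ i hi).trans (by simp)
      · refine (hdep i (Finset.mem_of_mem_erase hi)).trans ?_
        exact Finset.coe_subset.2 (Finset.union_subset_union_left hCJ)
    have hsplit : (fun ω : I → Prop => F ω * if (∀ i ∈ K, (ω i ↔ π i)) then (1 : ℝ) else 0)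
        = fun ω => (F ω * if (∀ i ∈ K', (ω i ↔ π i)) then 1 else 0)
          * if (ω j ↔ π j) then 1 else 0 := by
      funext ω
      rw [hKins]
      simp only [Finset.forall_mem_insert]
      by_cases h1 : (ω j ↔ π j) <;> by_cases h2 : (∀ i ∈ K', (ω i ↔ π i)) <;> simp [h1, h2]
    rw [hsplit, hf.netExp_node hcl (i := j) (by simp [hjJ, hjK'])
      ((hdep j hj).trans (Finset.coe_subset.2 (Finset.union_subset_union_left hCJ)))]
    · have hval : (fun ω : I → Prop => (F ω * if (∀ i ∈ K', (ω i ↔ π i)) then (1 : ℝ) else 0)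
          * bernoulliFactor (f j ω) (π j))
          = fun ω => bernoulliFactor (f j π) (π j)
            * (F ω * if (∀ i ∈ K', (ω i ↔ π i)) then 1 else 0) := by
        funext ω
        by_cases h0 : F ω = 0
        · simp [h0]
        by_cases h2 : (∀ i ∈ K', (ω i ↔ π i))
        · rw [hf.dependsOn j (x := ω) (y := π), mul_comm]
          intro i hi
          have := hdep j hj hi
          rcases Finset.mem_union.1 (Finset.mem_coe.1 this) with h | h
          · exact propext (hFC ω h0 i h)
          · exact propext (h2 i h)
        · simp [h2]
      rw [hval, hKins, Finset.prod_insert hjK', mul_assoc, ← ih']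
      simp only [netExp, Finset.mul_sum]
      exact Finset.sum_congr rfl fun ω _ => by ring
    · intro x y h
      have h3 : (∀ i ∈ K', (x i ↔ π i)) ↔ (∀ i ∈ K', (y i ↔ π i)) :=
        forall₂_congr fun i hi => by rw [h i (by simp [hi])]
      simp only [hF (fun i hi => h i (Finset.mem_coe.2 (Finset.mem_union_left _ hi))), h3]

lemma netExp_mono (h0 : ∀ i ω, 0 ≤ f i ω) (h1 : ∀ i ω, f i ω ≤ 1) {H H' : (I → Prop) → ℝ}
    (h : ∀ ω, H ω ≤ H' ω) : netExp f H ≤ netExp f H' :=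
  Finset.sum_le_sum fun ω _ => mul_le_mul_of_nonneg_left (h ω) (netWeight_nonneg h0 h1 _ ω)

lemma netExp_add (H H' : (I → Prop) → ℝ) :
    netExp f (fun ω => H ω + H' ω) = netExp f H + netExp f H' := by
  simp [netExp, mul_add, Finset.sum_add_distrib]

lemma netExp_const_mul (c : ℝ) (H : (I → Prop) → ℝ) :
    netExp f (fun ω => c * H ω) = c * netExp f H := by
  simp only [netExp, Finset.mul_sum]
  exact Finset.sum_congr rfl fun ω _ => by ring

lemma netExp_sum {ι : Type*} (s : Finset ι) (H : ι → (I → Prop) → ℝ) :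
    netExp f (fun ω => ∑ j ∈ s, H j ω) = ∑ j ∈ s, netExp f (H j) := by
  simp only [netExp, Finset.mul_sum]
  exact Finset.sum_comm

lemma netProb_nonneg (h0 : ∀ i ω, 0 ≤ f i ω) (h1 : ∀ i ω, f i ω ≤ 1) (X : Set (I → Prop)) :
    0 ≤ netProb f X :=
  Finset.sum_nonneg fun ω _ => mul_nonneg (netWeight_nonneg h0 h1 _ ω)
    (Set.indicator_nonneg (fun _ _ => zero_le_one) _)

lemma netProb_mono (h0 : ∀ i ω, 0 ≤ f i ω) (h1 : ∀ i ω, f i ω ≤ 1) {X Y : Set (I → Prop)}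
    (h : X ⊆ Y) : netProb f X ≤ netProb f Y :=
  netExp_mono h0 h1 fun ω => Set.indicator_le_indicator_of_subset h (fun _ => zero_le_one) ω

lemma netProb_iUnion_le {ι : Type*} [Fintype ι] (h0 : ∀ i ω, 0 ≤ f i ω) (h1 : ∀ i ω, f i ω ≤ 1)
    (X : ι → Set (I → Prop)) : netProb f (⋃ j, X j) ≤ ∑ j, netProb f (X j) := by
  unfold netProb
  rw [← netExp_sum]
  refine netExp_mono h0 h1 fun ω => ?_
  by_cases h : ω ∈ ⋃ j, X j
  · obtain ⟨j, hj⟩ := Set.mem_iUnion.1 h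
    rw [Set.indicator_of_mem h]
    calc (1 : (I → Prop) → ℝ) ω = (X j).indicator 1 ω := by rw [Set.indicator_of_mem hj]
      _ ≤ _ := Finset.single_le_sum (f := fun j => (X j).indicator (1 : (I → Prop) → ℝ) ω)
          (fun i _ => Set.indicator_nonneg (fun _ _ => zero_le_one) _) (Finset.mem_univ j)
  · rw [Set.indicator_of_notMem h]
    exact Finset.sum_nonneg fun i _ => Set.indicator_nonneg (fun _ _ => zero_le_one) _

lemma netProb_union_le (h0 : ∀ i ω, 0 ≤ f i ω) (h1 : ∀ i ω, f i ω ≤ 1) (X Y : Set (I → Prop)) :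
    netProb f (X ∪ Y) ≤ netProb f X + netProb f Y := by
  rw [Set.union_eq_iUnion]
  refine (netProb_iUnion_le h0 h1 _).trans ?_
  simp

lemma IsNet.netProb_univ (hf : IsNet f dep ρ) : netProb f Set.univ = 1 := by
  rw [netProb, Set.indicator_univ]
  exact hf.netExp_const 1

lemma netProb_add_compl (X : Set (I → Prop)) :
    netProb f X + netProb f Xᶜ = netProb f Set.univ := by
  unfold netProb
  rw [← netExp_add]
  congr 1
  funext ω
  by_cases h : ω ∈ X <;> simp [h]

lemma netProb_inter_add_diff (X Y : Set (I → Prop)) :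
    netProb f (X ∩ Y) + netProb f (X \ Y) = netProb f X := by
  unfold netProb
  rw [← netExp_add]
  congr 1
  funext ω
  by_cases h : ω ∈ X <;> by_cases h' : ω ∈ Y <;> simp [h, h']

lemma abs_netProb_sub_le_of_symmDiff (h0 : ∀ i ω, 0 ≤ f i ω) (h1 : ∀ i ω, f i ω ≤ 1)
    {X Y B : Set (I → Prop)} (h : ∀ ω, ω ∉ B → (ω ∈ X ↔ ω ∈ Y)) :
    |netProb f X - netProb f Y| ≤ netProb f B := by
  have h2 : netProb f X ≤ netProb f Y + netProb f B :=
    (netProb_mono h0 h1 fun ω hω => by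
      by_cases hB : ω ∈ B
      · exact Or.inr hB
      · exact Or.inl ((h ω hB).1 hω)).trans (netProb_union_le h0 h1 Y B)
  have h3 : netProb f Y ≤ netProb f X + netProb f B :=
    (netProb_mono h0 h1 fun ω hω => by
      by_cases hB : ω ∈ B
      · exact Or.inr hB
      · exact Or.inl ((h ω hB).2 hω)).trans (netProb_union_le h0 h1 X B)
  rw [abs_le]
  constructor <;> linarith

/-- Networks that agree outside an event `B` are close in total variation. -/
lemma IsNet.abs_netProb_sub_le (hf : IsNet f dep ρ) (hg : IsNet g dep' ρ')
    (hf0 : ∀ i ω, 0 ≤ f i ω) (hf1 : ∀ i ω, f i ω ≤ 1)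
    (hg0 : ∀ i ω, 0 ≤ g i ω) (hg1 : ∀ i ω, g i ω ≤ 1) {B : Set (I → Prop)}
    (h : ∀ ω, ω ∉ B → ∀ i, f i ω = g i ω) (X : Set (I → Prop)) :
    |netProb f X - netProb g X| ≤ netProb g B := by
  have key : ∀ Y : Set (I → Prop), netProb f (Y \ B) = netProb g (Y \ B) := by
    intro Y
    refine Finset.sum_congr rfl fun ω _ => ?_
    by_cases hω : ω ∈ Y \ B
    · congr 1
      exact Finset.prod_congr rfl fun i _ => by rw [h ω hω.2 i]
    · simp [hω]
  have hB : netProb f B = netProb g B := by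
    have h1 := netProb_add_compl (f := f) B
    have h2 := netProb_add_compl (f := g) B
    have h3 := key Set.univ
    rw [← Set.compl_eq_univ_sdiff] at h3
    rw [hf.netProb_univ] at h1
    rw [hg.netProb_univ] at h2
    linarith
  have e1 := netProb_inter_add_diff (f := f) X B
  have e2 := netProb_inter_add_diff (f := g) X B
  have b1 := netProb_mono hf0 hf1 (Set.inter_subset_right (s := X) (t := B))
  have b2 := netProb_mono hg0 hg1 (Set.inter_subset_right (s := X) (t := B))
  have c1 := netProb_nonneg hf0 hf1 (X ∩ B)
  have c2 := netProb_nonneg hg0 hg1 (X ∩ B)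
  have := key X
  rw [abs_le]
  constructor <;> linarith

end BayesNet

/-! ### Atomic types of tuples -/

namespace AtomicType

variable {σ : Type u} {ar : σ → ℕ} {S : Set σ}

/-- The complete atomic type over `S` of a tuple. -/
def typeOf {α : Type v} (S : Set σ) (A : RelStr ar α) {k : ℕ} (a : Fin k → α) :
    AtomicType ar S k where
  ident := Setoid.ker a
  holds := fun R t => A R (fun s => a (t s))
  congr := fun R s t h => by
    have : (fun i => a (s i)) = fun i => a (t i) := funext h
    rw [this]

lemma realizes_iff_typeOf_eq {α : Type v} {k : ℕ} (p : AtomicType ar S k) (A : RelStr ar α)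
    (a : Fin k → α) : p.Realizes A a ↔ typeOf S A a = p := by
  constructor
  · rintro ⟨h1, h2⟩
    ext1
    · exact h1
    · funext R t
      exact propext (h2 R t).symm
  · rintro rfl
    exact ⟨rfl, fun _ _ => Iff.rfl⟩

lemma typeOf_restrict {α : Type v} {d k : ℕ} (h : d ≤ k) (A : RelStr ar α) (a : Fin k → α) :
    (typeOf S A a).restrict h = typeOf S A (fun i => a (Fin.castLE h i)) := rfl

lemma Realizes.restrict {α : Type v} {d k : ℕ} (h : d ≤ k) {p : AtomicType ar S k}
    {A : RelStr ar α} {a : Fin k → α} (hp : p.Realizes A a) :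
    (p.restrict h).Realizes A (fun i => a (Fin.castLE h i)) := by
  rw [realizes_iff_typeOf_eq] at hp ⊢
  rw [← hp, typeOf_restrict]

instance finite [Finite σ] (k : ℕ) : Finite (AtomicType ar S k) := by
  have : Function.Injective fun p : AtomicType ar S k =>
      ((fun i j => p.ident i j : Fin k → Fin k → Prop), p.holds) := by
    intro p q h
    simp only [Prod.mk.injEq] at h
    ext1
    · ext i j
      exact iff_of_eq (congrFun (congrFun h.1 i) j)
    · exact h.2
  exact Finite.of_injective _ this

/-- A choice of one variable from every class of identified variables. -/
noncomputable def rep {k : ℕ} (p : AtomicType ar S k) (i : Fin k) : Fin k :=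
  (Quotient.mk p.ident i).out

lemma ident_rep {k : ℕ} (p : AtomicType ar S k) (i : Fin k) : p.ident (p.rep i) i :=
  Quotient.mk_out (s := p.ident) i

/-- Hence `p.rep` is a tuple in `Fin k` with exactly the equalities of `p`; it is the reference
tuple at which the probability of `p` is evaluated. -/
lemma ker_rep {k : ℕ} (p : AtomicType ar S k) : Setoid.ker p.rep = p.ident := by
  ext i j
  rw [Setoid.ker_def]
  constructor
  · intro h
    exact p.ident.trans (p.ident.symm (p.ident_rep i)) (h ▸ p.ident_rep j)
  · intro h
    exact congrArg Quotient.out (Quotient.sound (s := p.ident) h)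

/-- A last variable identified with an earlier one carries no information: replacing it by `i`
everywhere (the map `f`) turns each atom of `p` into an equivalent atom of the restriction. -/
lemma realizes_snoc_of_ident {α : Type v} {k : ℕ} {p : AtomicType ar S (k + 1)} {i : Fin k}
    (hi : p.ident i.castSucc (Fin.last k)) {A : RelStr ar α} {a : Fin k → α}
    (ha : (p.restrict k.le_succ).Realizes A a) (b : α) :
    p.Realizes A (Fin.snoc (α := fun _ => α) a b) ↔ b = a i := by
  constructor
  · intro h
    have : (Setoid.ker (Fin.snoc (α := fun _ => α) a b)) i.castSucc (Fin.last k) := h.1 ▸ hi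
    simpa [Setoid.ker_def] using this.symm
  · rintro rfl
    let f : Fin (k + 1) → Fin k := Fin.snoc (α := fun _ => Fin k) id i
    have hf : ∀ j, p.ident (f j).castSucc j := by
      intro j
      refine Fin.lastCases ?_ (fun j => ?_) j
      · simpa [f] using hi
      · simp [f]
    have hsnoc : (Fin.snoc (α := fun _ => α) a (a i) : Fin (k + 1) → α) = fun j => a (f j) := by
      funext j
      refine Fin.lastCases ?_ (fun j => ?_) j <;> simp [f]
    rw [hsnoc]
    constructor
    · ext x y
      rw [Setoid.ker_def]
      have h1 : a (f x) = a (f y) ↔ p.ident (f x).castSucc (f y).castSucc := by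
        rw [← Setoid.ker_def, ha.1]; rfl
      rw [h1]
      exact ⟨fun h => p.ident.trans (p.ident.symm (hf x)) (p.ident.trans h (hf y)),
        fun h => p.ident.trans (hf x) (p.ident.trans h (p.ident.symm (hf y)))⟩
    · intro R t
      rw [← ha.2 R (fun s => f (t s))]
      exact p.congr R _ _ fun s => p.ident.symm (hf (t s))

end AtomicType

/-! ### Structures as outcomes of a network on the ground atoms -/

section Ground

variable {σ : Type u} (ar : σ → ℕ)

/-- The atoms `R(t)` with `t` a tuple of elements of `{1, …, n}`. -/
abbrev GroundAtom (n : ℕ) : Type u := Σ R : σ, (Fin (ar R) → Fin n)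

variable {ar}

/-- The structure in which a given set of ground atoms holds. -/
def strOf {n : ℕ} (ω : GroundAtom ar n → Prop) : RelStr ar (Fin n) := fun R t => ω ⟨R, t⟩

open Classical in
/-- The ground atoms `R(t)` with `R` in `S` and the entries of `t` in `X`. -/
noncomputable def block [Fintype σ] (S : Set σ) {n : ℕ} (X : Set (Fin n)) :
    Finset (GroundAtom ar n) :=
  {i | i.1 ∈ S ∧ ∀ s, i.2 s ∈ X}

lemma mem_block [Fintype σ] {S : Set σ} {n : ℕ} {X : Set (Fin n)} {i : GroundAtom ar n} :
    i ∈ block S X ↔ i.1 ∈ S ∧ ∀ s, i.2 s ∈ X := by simp [block]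

namespace AtomicType

variable {S : Set σ}

/-- A structure in which the tuple `a` realizes `p`. -/
def modelAt {k n : ℕ} (p : AtomicType ar S k) (a : Fin k → Fin n) : GroundAtom ar n → Prop :=
  fun i => ∃ (h : i.1 ∈ S) (t : Fin (ar i.1) → Fin k), (i.2 = fun s => a (t s)) ∧ p.holds ⟨i.1, h⟩ t

/-- Several tuples of variables may name the same ground atom; `congr` guarantees that `p` treats
them alike. -/
lemma modelAt_realizes {k n : ℕ} (p : AtomicType ar S k) {a : Fin k → Fin n}
    (ha : Setoid.ker a = p.ident) : p.Realizes (strOf (p.modelAt a)) a := by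
  refine ⟨ha, fun R t => ⟨fun h => ⟨R.2, t, rfl, h⟩, ?_⟩⟩
  rintro ⟨_, t', h1, h2⟩
  refine (p.congr R t t' fun i => ?_).2 h2
  rw [← ha]
  exact congrFun h1 i

variable [Fintype σ]

/-- Relative to one fixed model `π`, realizing `p` means agreeing with `π` on a finite set of nodes,
which is the form of event treated by `IsNet.netExp_pattern`. -/
lemma Realizes.iff_forall_block {k n : ℕ} {p : AtomicType ar S k} {a : Fin k → Fin n}
    {π : GroundAtom ar n → Prop} (hπ : p.Realizes (strOf π) a) (ω : GroundAtom ar n → Prop) :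
    p.Realizes (strOf ω) a ↔ ∀ i ∈ block S (Set.range a), (ω i ↔ π i) := by
  constructor
  · rintro h ⟨R, t⟩ hi
    rw [mem_block] at hi
    obtain ⟨u, rfl⟩ : ∃ u : Fin (ar R) → Fin k, t = fun s => a (u s) := by
      choose u hu using hi.2
      exact ⟨u, funext fun s => (hu s).symm⟩
    exact (h.2 ⟨R, hi.1⟩ u).symm.trans (hπ.2 ⟨R, hi.1⟩ u)
  · intro h
    refine ⟨hπ.1, fun R t => (hπ.2 R t).trans (h ⟨R, fun s => a (t s)⟩ ?_).symm⟩
    exact mem_block.2 ⟨R.2, fun s => ⟨_, rfl⟩⟩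

lemma dependsOn_realizes {k n : ℕ} (p : AtomicType ar S k) {a : Fin k → Fin n} {X : Set (Fin n)}
    (ha : ∀ i, a i ∈ X) :
    DependsOn (fun ω : GroundAtom ar n → Prop => p.Realizes (strOf ω) a) (block (ar := ar) S X) := by
  intro ω ω' h
  have : ∀ (R : S) (t : Fin (ar R) → Fin k),
      strOf ω R (fun s => a (t s)) = strOf ω' R (fun s => a (t s)) := fun R t =>
    h ⟨R, _⟩ (Finset.mem_coe.2 (mem_block.2 ⟨R.2, fun s => ha _⟩))
  simp only [Realizes, this]

end AtomicType

end Ground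

/-! ### Networks in which an atom depends only on the type of its arguments -/

/-- A network in which the probability of `R(t)` depends only on the atomic type of `t` over `par R`. -/
structure LocalNet {σ : Type u} (ar : σ → ℕ) (par : σ → Set σ) where
  rank : σ → ℕ
  rank_lt : ∀ R, ∀ Q ∈ par R, rank Q < rank R
  prob : (R : σ) → AtomicType ar (par R) (ar R) → ℝ
  prob_nonneg : ∀ R p, 0 ≤ prob R p
  prob_le_one : ∀ R p, prob R p ≤ 1

namespace LocalNet

open AtomicType Classical

variable {σ : Type u} {ar : σ → ℕ} {par : σ → Set σ} (L : LocalNet ar par)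

/-- The conditional probabilities of the ground atoms. -/
noncomputable def nodeProb (n : ℕ) (i : GroundAtom ar n) (ω : GroundAtom ar n → Prop) : ℝ :=
  L.prob i.1 (typeOf (par i.1) (strOf ω) i.2)

lemma nodeProb_nonneg (n : ℕ) (i : GroundAtom ar n) (ω : GroundAtom ar n → Prop) :
    0 ≤ L.nodeProb n i ω := L.prob_nonneg _ _

lemma nodeProb_le_one (n : ℕ) (i : GroundAtom ar n) (ω : GroundAtom ar n → Prop) :
    L.nodeProb n i ω ≤ 1 := L.prob_le_one _ _

variable (par) in
/-- The ground atoms on which the probability of a ground atom depends in a local network. -/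
def localDep (n : ℕ) (i : GroundAtom ar n) : Set (GroundAtom ar n) :=
  {j | j.1 ∈ par i.1 ∧ ∀ s, j.2 s ∈ Set.range i.2}

lemma isNet (n : ℕ) : IsNet (L.nodeProb n) (localDep par n) (fun i => L.rank i.1) where
  dependsOn := by
    intro i ω ω' h
    have : typeOf (par i.1) (strOf ω) i.2 = typeOf (par i.1) (strOf ω') i.2 := by
      ext1
      · rfl
      · funext R t
        exact h ⟨R, fun s => i.2 (t s)⟩ ⟨R.2, fun s => ⟨_, rfl⟩⟩
    simp only [nodeProb, this]
  rank_lt := fun i j hj => L.rank_lt _ _ hj.1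

variable [Fintype σ]

lemma localDep_subset_block {S : Set σ} (hS : ∀ R ∈ S, par R ⊆ S) {n : ℕ} (X : Set (Fin n))
    (i : GroundAtom ar n) (hi : i ∈ block S X) : localDep par n i ⊆ block (ar := ar) S X := by
  intro j hj
  rw [mem_block] at hi
  refine Finset.mem_coe.2 (mem_block.2 ⟨hS _ hi.1 hj.1, fun s => ?_⟩)
  obtain ⟨x, hx⟩ := hj.2 s
  rw [← hx]
  exact hi.2 x

/-- The probability of a set of structures with domain `{1, …, n}`. -/
noncomputable def strProb (n : ℕ) (X : Set (RelStr ar (Fin n))) : ℝ :=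
  netProb (L.nodeProb n) (strOf ⁻¹' X)

/-- The probability of an atomic type. -/
noncomputable def typeProb {S : Set σ} {k : ℕ} (p : AtomicType ar S k) : ℝ :=
  L.strProb k {A | p.Realizes A p.rep}

variable {L}

lemma strProb_nonneg {n : ℕ} (X : Set (RelStr ar (Fin n))) : 0 ≤ L.strProb n X :=
  netProb_nonneg (L.nodeProb_nonneg n) (L.nodeProb_le_one n) _

lemma strProb_mono {n : ℕ} {X Y : Set (RelStr ar (Fin n))} (h : X ⊆ Y) :
    L.strProb n X ≤ L.strProb n Y :=
  netProb_mono (L.nodeProb_nonneg n) (L.nodeProb_le_one n) (Set.preimage_mono h)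

lemma strProb_union_le {n : ℕ} (X Y : Set (RelStr ar (Fin n))) :
    L.strProb n (X ∪ Y) ≤ L.strProb n X + L.strProb n Y :=
  netProb_union_le (L.nodeProb_nonneg n) (L.nodeProb_le_one n) _ _

lemma strProb_univ (n : ℕ) : L.strProb n Set.univ = 1 := (L.isNet n).netProb_univ

lemma typeProb_nonneg {S : Set σ} {k : ℕ} (p : AtomicType ar S k) : 0 ≤ L.typeProb p :=
  strProb_nonneg _

/-- The chain rule with nothing conditioned on: the block of `a` is closed under parents. -/
lemma strProb_realizes_eq_prod {S : Set σ} (hS : ∀ R ∈ S, par R ⊆ S) {k n : ℕ}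
    (p : AtomicType ar S k) {a : Fin k → Fin n} (ha : Setoid.ker a = p.ident) :
    L.strProb n {A | p.Realizes A a} = ∏ i ∈ block S (Set.range a),
      bernoulliFactor (L.nodeProb n i (p.modelAt a)) (p.modelAt a i) := by
  have h := (L.isNet n).netExp_pattern (J := ∅) (C := ∅) (by simp) (p.modelAt a)
    (F := fun _ => 1) (fun _ _ _ => rfl) subset_rfl (by simp) (K := block S (Set.range a))
    (by simp) (by simpa using localDep_subset_block hS (Set.range a))
  rw [(L.isNet n).netExp_const, mul_one] at h
  rw [← h, strProb, netProb]
  congr 1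
  funext ω
  have := (p.modelAt_realizes ha).iff_forall_block ω
  simp only [one_mul, Set.indicator_apply, Set.mem_preimage, Set.mem_ofPred_eq, Pi.one_apply]
  split_ifs <;> simp_all

/-- The probability of `p(a)` does not depend on `n` and `a`. -/
theorem strProb_realizes {S : Set σ} (hS : ∀ R ∈ S, par R ⊆ S) {k n : ℕ}
    (p : AtomicType ar S k) {a : Fin k → Fin n} (ha : Setoid.ker a = p.ident) :
    L.strProb n {A | p.Realizes A a} = L.typeProb p := by
  rw [typeProb, strProb_realizes_eq_prod hS p ha, strProb_realizes_eq_prod hS p p.ker_rep]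
  symm
  have ha_rep : ∀ i, a (p.rep i) = a i := fun i => by
    have := p.ident_rep i
    rwa [← ha] at this
  have hrep : ∀ x ∈ Set.range p.rep, p.rep x = x := by
    rintro _ ⟨i, rfl⟩
    have := p.ident_rep i
    rwa [← p.ker_rep] at this
  have hinj : ∀ x ∈ Set.range p.rep, ∀ y ∈ Set.range p.rep, a x = a y → x = y := by
    intro x hx y hy h
    have : p.ident x y := ha ▸ h
    rw [← p.ker_rep] at this
    rw [← hrep x hx, ← hrep y hy]
    exact this
  -- Relabelling along `a` is a bijection from the ground atoms over `Set.range p.rep` to those over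
  -- `Set.range a`. It preserves truth values and the types of arguments, hence every factor of the
  -- product.
  refine Finset.prod_bij (fun i _ => ⟨i.1, fun s => a (i.2 s)⟩) ?_ ?_ ?_ ?_
  · intro i hi
    exact mem_block.2 ⟨(mem_block.1 hi).1, fun s => ⟨_, rfl⟩⟩
  · rintro ⟨R, t⟩ hi ⟨R', t'⟩ hi' h
    obtain ⟨rfl, h⟩ := Sigma.mk.inj_iff.1 h
    have h := eq_of_heq h
    have h1 := (mem_block.1 hi).2
    have h2 := (mem_block.1 hi').2
    have : t = t' := funext fun s => hinj _ (h1 s) _ (h2 s) (congrFun h s)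
    rw [this]
  · rintro ⟨R, t⟩ hi
    have h1 := mem_block.1 hi
    choose u hu using h1.2
    refine ⟨⟨R, fun s => p.rep (u s)⟩, mem_block.2 ⟨h1.1, fun s => ⟨_, rfl⟩⟩, ?_⟩
    have : (fun s => a (p.rep (u s))) = t := funext fun s => (ha_rep _).trans (hu s)
    simp only [this]
  · rintro ⟨R, t⟩ hi
    have h1 := mem_block.1 hi
    have ht : ∀ s, p.rep (t s) = t s := fun s => hrep _ (h1.2 s)
    have m1 := p.modelAt_realizes p.ker_rep
    have m2 := p.modelAt_realizes ha
    have key : ∀ (Q : σ) (_ : Q ∈ S) (s : Fin (ar Q) → Fin (ar R)),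
        (strOf (p.modelAt p.rep) Q fun x => t (s x)) ↔ strOf (p.modelAt a) Q fun x => a (t (s x)) := by
      intro Q hQ s
      rw [← m2.2 ⟨Q, hQ⟩ (fun x => t (s x)), m1.2 ⟨Q, hQ⟩ (fun x => t (s x))]
      simp only [ht]
    have e1 : p.modelAt p.rep ⟨R, t⟩ ↔ p.modelAt a ⟨R, fun s => a (t s)⟩ := key R h1.1 id
    have e2 : typeOf (par R) (strOf (p.modelAt p.rep)) t
        = typeOf (par R) (strOf (p.modelAt a)) (fun s => a (t s)) := by
      ext1
      · ext x y
        exact ⟨fun h => congrArg a h, fun h => hinj _ (h1.2 x) _ (h1.2 y) h⟩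
      · funext Q s
        exact propext (key Q (hS R h1.1 Q.2) s)
    simp only [nodeProb, e2, e1]

end LocalNet

/-! ### Concentration of the number of extensions of a tuple -/

namespace LocalNet

open AtomicType Classical

variable {σ : Type u} {ar : σ → ℕ} {par : σ → Set σ} {L : LocalNet ar par} {S : Set σ}

lemma ker_snoc {k n : ℕ} {p : AtomicType ar S (k + 1)}
    (hp : ∀ i : Fin k, ¬ p.ident i.castSucc (Fin.last k)) {a : Fin k → Fin n}
    (ha : Setoid.ker a = (p.restrict k.le_succ).ident) {b : Fin n} (hb : b ∉ Set.range a) :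
    Setoid.ker (Fin.snoc (α := fun _ => Fin n) a b) = p.ident := by
  ext x y
  rw [Setoid.ker_def]
  refine Fin.lastCases ?_ (fun x => ?_) x <;> refine Fin.lastCases ?_ (fun y => ?_) y
  · simp
  · simp only [Fin.snoc_last, Fin.snoc_castSucc]
    exact ⟨fun h => absurd ⟨y, h.symm⟩ hb, fun h => absurd (p.ident.symm h) (hp y)⟩
  · simp only [Fin.snoc_last, Fin.snoc_castSucc]
    exact ⟨fun h => absurd ⟨x, h⟩ hb, fun h => absurd h (hp x)⟩
  · simp only [Fin.snoc_castSucc]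
    rw [← Setoid.ker_def, ha]
    rfl

lemma range_snoc_subset {k n : ℕ} (a : Fin k → Fin n) (b : Fin n) (i : Fin (k + 1)) :
    (Fin.snoc (α := fun _ => Fin n) a b : Fin (k + 1) → Fin n) i ∈ insert b (Set.range a) := by
  refine Fin.lastCases ?_ (fun i => ?_) i <;> simp

variable [Fintype σ]

/-- The ground atoms with arguments in `X ∪ {b}` for some `b` in `D`. -/
noncomputable def star (S : Set σ) {n : ℕ} (X : Set (Fin n)) (D : Finset (Fin n)) :
    Finset (GroundAtom ar n) :=
  block S X ∪ D.biUnion fun b => block S (insert b X)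

/-- Conditional independence of extensions. Given `q(a)`, the event `p(a, b)` is decided by the
atoms over `a` and `b` that are not over `a` alone. Their parents lie over `a` and `b` too, so other
elements `c` in `D` have no influence, and the conditional probability is always `P(p) / P(q)`. -/
lemma netExp_mul_realizes (hS : ∀ R ∈ S, par R ⊆ S) {k n : ℕ} {p : AtomicType ar S (k + 1)}
    (hp : ∀ i : Fin k, ¬ p.ident i.castSucc (Fin.last k)) {a : Fin k → Fin n}
    (ha : Setoid.ker a = (p.restrict k.le_succ).ident) {b : Fin n} (hb : b ∉ Set.range a)
    {D : Finset (Fin n)} (hbD : b ∉ D) {F : (GroundAtom ar n → Prop) → ℝ}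
    (hF : DependsOn F (star (ar := ar) S (Set.range a) D))
    (hF0 : ∀ ω, F ω ≠ 0 → (p.restrict k.le_succ).Realizes (strOf ω) a) :
    netExp (L.nodeProb n) (fun ω => F ω *
        if p.Realizes (strOf ω) (Fin.snoc (α := fun _ => Fin n) a b) then 1 else 0)
      * L.typeProb (p.restrict k.le_succ) = L.typeProb p * netExp (L.nodeProb n) F := by
  set q := p.restrict k.le_succ with hq
  set ab : Fin (k + 1) → Fin n := Fin.snoc (α := fun _ => Fin n) a b with hab
  have hker : Setoid.ker ab = p.ident := ker_snoc hp ha hb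
  set π := p.modelAt ab with hπ
  have mp : p.Realizes (strOf π) ab := p.modelAt_realizes hker
  have hqa : ∀ A : RelStr ar (Fin n), p.Realizes A ab → q.Realizes A a := by
    intro A h
    have := h.restrict k.le_succ
    convert this using 1
    funext i
    exact (Fin.snoc_castSucc (α := fun _ => Fin n) b a i).symm
  have mq : q.Realizes (strOf π) a := hqa _ mp
  have hrange : Set.range ab = insert b (Set.range a) := by
    ext x
    constructor
    · rintro ⟨i, rfl⟩
      exact range_snoc_subset a b i
    · rintro (rfl | ⟨i, rfl⟩)
      · exact ⟨Fin.last k, by simp [hab]⟩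
      · exact ⟨i.castSucc, by simp [hab]⟩
  let C : Finset (GroundAtom ar n) := block S (Set.range a)
  let K : Finset (GroundAtom ar n) := block S (Set.range ab) \ C
  have hCK : C ∪ K = block S (Set.range ab) := by
    refine Finset.union_sdiff_of_subset fun i hi => ?_
    rw [mem_block] at hi ⊢
    exact ⟨hi.1, fun s => by rw [hrange]; exact Set.mem_insert_of_mem _ (hi.2 s)⟩
  -- Used twice: for the given `D` and `F`, and for the empty set with the indicator of `q(a)`. The
  -- second use identifies the product over `K` as the factor relating `P(p)` to `P(q)`.
  have hmain : ∀ (E : Finset (Fin n)) (_ : b ∉ E) (F : (GroundAtom ar n → Prop) → ℝ)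
      (_ : DependsOn F (star (ar := ar) S (Set.range a) E))
      (_ : ∀ ω, F ω ≠ 0 → q.Realizes (strOf ω) a),
      netExp (L.nodeProb n) (fun ω => F ω * if p.Realizes (strOf ω) ab then 1 else 0)
        = (∏ i ∈ K, bernoulliFactor (L.nodeProb n i π) (π i)) * netExp (L.nodeProb n) F := by
    intro E hbE F hF hF0
    rw [← (L.isNet n).netExp_pattern (J := star S (Set.range a) E) (C := C) ?_ π hF
      Finset.subset_union_left (fun ω h => (mq.iff_forall_block ω).1 (hF0 ω h)) ?_ ?_]
    · congr 1
      funext ω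
      by_cases h0 : F ω = 0
      · simp [h0]
      congr 1
      have h1 := (mq.iff_forall_block ω).1 (hF0 ω h0)
      have h2 := mp.iff_forall_block ω
      rw [← hCK] at h2
      have h3 : p.Realizes (strOf ω) ab ↔ ∀ i ∈ K, (ω i ↔ π i) := by
        rw [h2]
        constructor
        · exact fun h i hi => h i (Finset.mem_union_right _ hi)
        · intro h i hi
          rcases Finset.mem_union.1 hi with hi | hi
          · exact h1 i hi
          · exact h i hi
      by_cases h4 : p.Realizes (strOf ω) ab
      · rw [if_pos h4, if_pos (h3.1 h4)]
      · rw [if_neg h4, if_neg (fun h => h4 (h3.2 h))]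
    · intro i hi
      rcases Finset.mem_union.1 hi with hi | hi
      · exact (localDep_subset_block hS _ i hi).trans
          (Finset.coe_subset.2 Finset.subset_union_left)
      · obtain ⟨c, hc, hi⟩ := Finset.mem_biUnion.1 hi
        refine (localDep_subset_block hS _ i hi).trans (Finset.coe_subset.2 ?_)
        exact (Finset.subset_biUnion_of_mem (fun b => block S (insert b (Set.range a))) hc).trans
          Finset.subset_union_right
    -- An atom whose entries lie both in `range a ∪ {b}` and in `range a ∪ {c}`, where `c ≠ b`, has
    -- all entries in `range a`.
    · rw [Finset.disjoint_left]
      intro i hi hi'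
      obtain ⟨hi1, hi2⟩ := Finset.mem_sdiff.1 hi
      rcases Finset.mem_union.1 hi' with hi' | hi'
      · exact hi2 hi'
      · obtain ⟨c, hc, hi'⟩ := Finset.mem_biUnion.1 hi'
        refine hi2 (mem_block.2 ⟨(mem_block.1 hi1).1, fun s => ?_⟩)
        have h1 := (mem_block.1 hi1).2 s
        have h2 := (mem_block.1 hi').2 s
        rw [hrange] at h1
        rcases h1 with h1 | h1
        · rcases h2 with h2 | h2
          · exact absurd (h1.symm.trans h2 ▸ hc) hbE
          · exact h2
        · exact h1
    · intro i hi
      rw [← Finset.coe_union, hCK]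
      exact localDep_subset_block hS _ i (Finset.mem_sdiff.1 hi).1
  have hvp : L.typeProb p
      = (∏ i ∈ K, bernoulliFactor (L.nodeProb n i π) (π i)) * L.typeProb q := by
    rw [← strProb_realizes hS p hker, ← strProb_realizes hS q ha, strProb, strProb, netProb, netProb,
      ← hmain ∅ (by simp)]
    · congr 1
      funext ω
      by_cases h : p.Realizes (strOf ω) ab
      · simp [h, hqa _ h]
      · simp [h]
    · intro ω ω' h
      have := q.dependsOn_realizes (a := a) (X := Set.range a) (fun i => ⟨i, rfl⟩)
        (fun i hi => h i (Finset.mem_union_left _ hi))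
      have h2 : ω ∈ strOf ⁻¹' {A | q.Realizes A a} ↔ ω' ∈ strOf ⁻¹' {A | q.Realizes A a} :=
        iff_of_eq this
      by_cases h3 : ω' ∈ strOf ⁻¹' {A | q.Realizes A a}
      · rw [Set.indicator_of_mem h3, Set.indicator_of_mem (h2.2 h3)]; rfl
      · rw [Set.indicator_of_notMem h3, Set.indicator_of_notMem (fun h => h3 (h2.1 h))]
    · intro ω h
      by_contra h2
      exact h (Set.indicator_of_notMem (s := strOf ⁻¹' {A | q.Realizes A a}) h2 _)
  rw [hmain D hbD F hF hF0, hvp]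
  ring

/-- The moment generating function of the number of extensions. -/
lemma netExp_prod (hS : ∀ R ∈ S, par R ⊆ S) {k n : ℕ} {p : AtomicType ar S (k + 1)}
    (hp : ∀ i : Fin k, ¬ p.ident i.castSucc (Fin.last k))
    (hq : 0 < L.typeProb (p.restrict k.le_succ)) {a : Fin k → Fin n}
    (ha : Setoid.ker a = (p.restrict k.le_succ).ident) (y : ℝ) (D : Finset (Fin n))
    (hD : ∀ b ∈ D, b ∉ Set.range a) :
    netExp (L.nodeProb n) (fun ω => (if (p.restrict k.le_succ).Realizes (strOf ω) a then 1 else 0) *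
        ∏ b ∈ D, if p.Realizes (strOf ω) (Fin.snoc (α := fun _ => Fin n) a b) then y else 1)
      = L.typeProb (p.restrict k.le_succ) *
        (1 + (y - 1) * (L.typeProb p / L.typeProb (p.restrict k.le_succ))) ^ D.card := by
  induction D using Finset.induction_on with
  | empty =>
    rw [Finset.card_empty, pow_zero, mul_one, ← strProb_realizes hS _ ha, strProb, netProb]
    congr 1
    funext ω
    simp [Set.indicator_apply]
  | insert b D hb ih =>
    have ih := ih fun c hc => hD c (Finset.mem_insert_of_mem hc)
    set F : (GroundAtom ar n → Prop) → ℝ := fun ω =>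
      (if (p.restrict k.le_succ).Realizes (strOf ω) a then 1 else 0) *
        ∏ b ∈ D, if p.Realizes (strOf ω) (Fin.snoc (α := fun _ => Fin n) a b) then y else 1 with hF
    have hdep : DependsOn F (star (ar := ar) S (Set.range a) D) := by
      intro ω ω' h
      have h1 : (p.restrict k.le_succ).Realizes (strOf ω) a
          = (p.restrict k.le_succ).Realizes (strOf ω') a :=
        AtomicType.dependsOn_realizes _ (X := Set.range a) (fun i => ⟨i, rfl⟩)
          (fun i hi => h i (Finset.mem_union_left _ hi))
      have h2 : ∀ b ∈ D, p.Realizes (strOf ω) (Fin.snoc (α := fun _ => Fin n) a b)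
          = p.Realizes (strOf ω') (Fin.snoc (α := fun _ => Fin n) a b) := fun b hb =>
        AtomicType.dependsOn_realizes _ (range_snoc_subset a b)
          (fun i hi => h i (Finset.mem_union_right _ (Finset.mem_biUnion.2 ⟨b, hb, hi⟩)))
      simp only [hF, h1]
      congr 1
      exact Finset.prod_congr rfl fun b hb => by simp only [h2 b hb]
    have hstep := netExp_mul_realizes (L := L) hS hp ha (hD b (Finset.mem_insert_self b D)) hb hdep
      (fun ω h => by
        by_contra h2
        exact h (by simp [hF, h2]))
    -- The factor of the new element is `1 + (y - 1)` times the indicator of `p(a, b)`, so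
    -- independence applies to the second summand.
    have hsplit : (fun ω : GroundAtom ar n → Prop =>
        (if (p.restrict k.le_succ).Realizes (strOf ω) a then (1 : ℝ) else 0) *
          ∏ b ∈ insert b D, if p.Realizes (strOf ω) (Fin.snoc (α := fun _ => Fin n) a b)
            then y else 1)
        = fun ω => F ω + (y - 1) *
          (F ω * if p.Realizes (strOf ω) (Fin.snoc (α := fun _ => Fin n) a b) then 1 else 0) := by
      funext ω
      rw [Finset.prod_insert hb]
      simp only [hF]
      by_cases h : p.Realizes (strOf ω) (Fin.snoc (α := fun _ => Fin n) a b)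
      · simp only [h, if_true]; ring
      · simp only [h, if_false]; ring
    rw [hsplit, netExp_add, netExp_const_mul, eq_div_of_mul_eq hq.ne' hstep, ih,
      Finset.card_insert_of_notMem hb, pow_succ]
    field_simp

/-- The number of `b` such that `(a, b)` realizes `p`. -/
noncomputable def extCount {k n : ℕ} (p : AtomicType ar S (k + 1)) (A : RelStr ar (Fin n))
    (a : Fin k → Fin n) : ℕ :=
  {b : Fin n | p.Realizes A (Fin.snoc (α := fun _ => Fin n) a b)}.ncard

lemma typeProb_le_restrict (hS : ∀ R ∈ S, par R ⊆ S) {d k : ℕ} (h : d ≤ k)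
    (p : AtomicType ar S k) : L.typeProb p ≤ L.typeProb (p.restrict h) := by
  have hker : Setoid.ker (fun i => p.rep (Fin.castLE h i)) = (p.restrict h).ident := by
    show Setoid.comap (Fin.castLE h) (Setoid.ker p.rep) = _
    rw [p.ker_rep]
    rfl
  rw [← strProb_realizes hS (p.restrict h) hker]
  exact strProb_mono fun A hA => hA.restrict h

/-- The exponent of a centred binomial moment generating function with `m` trials, of which up to
`k` are missing from `n`. Since `exp x - 1 ≤ x + x ^ 2`, the linear terms cancel up to `|x| * k`. -/
lemma exp_moment_bound {γ x k n m : ℝ} (hγ0 : 0 ≤ γ) (hγ1 : γ ≤ 1) (hx : |x| ≤ 1) (hk : 0 ≤ k)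
    (hm0 : 0 ≤ m) (hm : m ≤ n) (hmk : n - k ≤ m) :
    γ * ((Real.exp x - 1) * m - x * n) ≤ |x| * k + x ^ 2 * n := by
  have h1 : Real.exp x - 1 ≤ x + x ^ 2 := by
    have := (abs_le.1 (Real.abs_exp_sub_one_sub_id_le hx)).2
    linarith
  have h2 : (Real.exp x - 1) * m ≤ (x + x ^ 2) * m := mul_le_mul_of_nonneg_right h1 hm0
  have h3 : x * (m - n) ≤ |x| * k := by
    calc x * (m - n) ≤ |x * (m - n)| := le_abs_self _
      _ = |x| * |m - n| := abs_mul _ _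
      _ ≤ |x| * k := by
        refine mul_le_mul_of_nonneg_left ?_ (abs_nonneg x)
        rw [abs_le]; constructor <;> linarith
  have h4 : x ^ 2 * m ≤ x ^ 2 * n := mul_le_mul_of_nonneg_left hm (sq_nonneg x)
  have h5 : 0 ≤ |x| * k + x ^ 2 * n := by
    have := abs_nonneg x
    have : 0 ≤ n := hm0.trans hm
    positivity
  have h6 : (Real.exp x - 1) * m - x * n ≤ |x| * k + x ^ 2 * n := by nlinarith
  calc γ * ((Real.exp x - 1) * m - x * n) ≤ γ * (|x| * k + x ^ 2 * n) :=
        mul_le_mul_of_nonneg_left h6 hγ0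
    _ ≤ 1 * (|x| * k + x ^ 2 * n) := mul_le_mul_of_nonneg_right hγ1 h5
    _ = _ := one_mul _

/-- Entries of `a` never count as extensions, because `p` keeps its last variable distinct. So the
count is binomial over the at least `n - k` other elements, and `1 + t ≤ exp t` bounds its moment
generating function. -/
lemma netExp_exp_le (hS : ∀ R ∈ S, par R ⊆ S) {k n : ℕ} {p : AtomicType ar S (k + 1)}
    (hp : ∀ i : Fin k, ¬ p.ident i.castSucc (Fin.last k))
    (hq : 0 < L.typeProb (p.restrict k.le_succ)) {a : Fin k → Fin n}
    (ha : Setoid.ker a = (p.restrict k.le_succ).ident) {x : ℝ} (hx : |x| ≤ 1) :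
    netExp (L.nodeProb n) (fun ω => (if (p.restrict k.le_succ).Realizes (strOf ω) a then 1 else 0) *
        Real.exp (x * (extCount p (strOf ω) a
          - L.typeProb p / L.typeProb (p.restrict k.le_succ) * n)))
      ≤ Real.exp (|x| * k + x ^ 2 * n) := by
  set q := p.restrict k.le_succ
  set γ := L.typeProb p / L.typeProb q with hγ
  have hγ0 : 0 ≤ γ := div_nonneg (typeProb_nonneg p) hq.le
  have hγ1 : γ ≤ 1 := div_le_one_of_le₀ (typeProb_le_restrict hS _ p) hq.le
  set D : Finset (Fin n) := Finset.univ.filter fun b => b ∉ Set.range a with hD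
  have hcount : ∀ ω : GroundAtom ar n → Prop, Real.exp (x * extCount p (strOf ω) a)
      = ∏ b ∈ D, if p.Realizes (strOf ω) (Fin.snoc (α := fun _ => Fin n) a b)
          then Real.exp x else 1 := by
    intro ω
    rw [Finset.prod_ite, Finset.prod_const, Finset.prod_const_one, mul_one, mul_comm, Real.exp_nat_mul]
    congr 1
    rw [extCount, Set.ncard_eq_toFinset_card']
    congr 1
    ext b
    simp only [Set.mem_toFinset, Set.mem_ofPred_eq, Finset.mem_filter, hD, Finset.mem_univ, true_and]
    refine ⟨fun h => ⟨?_, h⟩, fun h => h.2⟩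
    rintro ⟨i, rfl⟩
    refine hp i ?_
    rw [← h.1, Setoid.ker_def]
    simp
  have hDn : D.card ≤ n := by simpa using Finset.card_le_univ D
  have hDk : (n : ℝ) - k ≤ D.card := by
    have h1 : (Finset.univ.image a).card ≤ k := by
      simpa using Finset.card_image_le (s := Finset.univ) (f := a)
    have h2 : D = (Finset.univ.image a)ᶜ := by
      ext b
      simp [hD]
    have h3 : D.card + (Finset.univ.image a).card = n := by
      rw [h2, Finset.card_compl_add_card, Fintype.card_fin]
    have h4 : n ≤ D.card + k := by omega
    have : (n : ℝ) ≤ D.card + k := by exact_mod_cast h4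
    linarith
  have hE := netExp_prod (L := L) hS hp hq ha (Real.exp x) D (fun b hb => (Finset.mem_filter.1 hb).2)
  have hfun : (fun ω : GroundAtom ar n → Prop => (if q.Realizes (strOf ω) a then (1 : ℝ) else 0) *
        Real.exp (x * (extCount p (strOf ω) a - γ * n)))
      = fun ω => Real.exp (-(x * γ * n)) * ((if q.Realizes (strOf ω) a then 1 else 0) *
        ∏ b ∈ D, if p.Realizes (strOf ω) (Fin.snoc (α := fun _ => Fin n) a b)
          then Real.exp x else 1) := by
    funext ω
    rw [← hcount, mul_left_comm, ← Real.exp_add]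
    congr 2
    ring
  rw [hfun, netExp_const_mul, hE]
  have hq1 : L.typeProb q ≤ 1 := (strProb_mono (Set.subset_univ _)).trans (strProb_univ _).le
  have hbase : 0 ≤ 1 + (Real.exp x - 1) * γ := by
    have := Real.exp_pos x
    nlinarith
  have h1 : (1 + (Real.exp x - 1) * γ) ^ D.card ≤ Real.exp (D.card * ((Real.exp x - 1) * γ)) := by
    rw [Real.exp_nat_mul]
    refine pow_le_pow_left₀ hbase ?_ _
    linarith [Real.add_one_le_exp ((Real.exp x - 1) * γ)]
  calc Real.exp (-(x * γ * n)) * (L.typeProb q * (1 + (Real.exp x - 1) * γ) ^ D.card)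
      ≤ Real.exp (-(x * γ * n)) * (1 * Real.exp (D.card * ((Real.exp x - 1) * γ))) := by
        gcongr
    _ = Real.exp (γ * ((Real.exp x - 1) * D.card - x * n)) := by
        rw [one_mul, ← Real.exp_add]
        congr 1
        ring
    _ ≤ _ := Real.exp_le_exp.2 (exp_moment_bound hγ0 hγ1 hx (Nat.cast_nonneg k)
        (Nat.cast_nonneg _) (by exact_mod_cast hDn) hDk)

/-- The number of extensions of a realization of `q` to one of `p` deviates from its expectation by
`ε n` only with exponentially small probability. -/
theorem strProb_extCount_le (hS : ∀ R ∈ S, par R ⊆ S) {k n : ℕ} {p : AtomicType ar S (k + 1)}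
    (hp : ∀ i : Fin k, ¬ p.ident i.castSucc (Fin.last k))
    (hq : 0 < L.typeProb (p.restrict k.le_succ)) (a : Fin k → Fin n) {ε : ℝ} (hε : 0 < ε)
    (hε1 : ε ≤ 1) :
    L.strProb n {A | (p.restrict k.le_succ).Realizes A a ∧
        ε * n < |extCount p A a - L.typeProb p / L.typeProb (p.restrict k.le_succ) * n|}
      ≤ 2 * Real.exp (ε / 2 * k) * Real.exp (-(ε ^ 2 / 4 * n)) := by
  by_cases ha : Setoid.ker a = (p.restrict k.le_succ).ident
  swap
  · have : {A : RelStr ar (Fin n) | (p.restrict k.le_succ).Realizes A a ∧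
        ε * n < |extCount p A a - L.typeProb p / L.typeProb (p.restrict k.le_succ) * n|} = ∅ := by
      ext A
      simp only [Set.mem_ofPred_eq, Set.mem_empty_iff_false, iff_false]
      exact fun h => ha h.1.1
    rw [this, strProb, Set.preimage_empty, netProb, Set.indicator_empty]
    have : netExp (L.nodeProb n) (fun _ => 0) = 0 := (L.isNet n).netExp_const 0
    rw [this]
    positivity
  set γ := L.typeProb p / L.typeProb (p.restrict k.le_succ)
  -- Chernoff's method with `x = ±ε / 2`, the choice minimizing `x ^ 2 - ε |x|`; the minimum `-ε ^ 2
  -- / 4` is the decay rate. The two signs treat the two tails.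
  have hx : |ε / 2| ≤ 1 := by rw [abs_of_pos (by positivity)]; linarith
  have e1 := netExp_exp_le (L := L) hS hp hq ha hx
  have e2 := netExp_exp_le (L := L) hS hp hq ha (x := -(ε / 2)) (by rwa [abs_neg])
  rw [abs_neg, neg_sq] at e2
  rw [abs_of_pos (half_pos hε)] at e1 e2
  have hle : L.strProb n {A | (p.restrict k.le_succ).Realizes A a ∧ ε * n < |extCount p A a - γ * n|}
      ≤ netExp (L.nodeProb n) (fun ω => Real.exp (-(ε / 2 * (ε * n))) *
        ((if (p.restrict k.le_succ).Realizes (strOf ω) a then 1 else 0) *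
          Real.exp (ε / 2 * (extCount p (strOf ω) a - γ * n))
        + (if (p.restrict k.le_succ).Realizes (strOf ω) a then 1 else 0) *
          Real.exp (-(ε / 2) * (extCount p (strOf ω) a - γ * n)))) := by
    refine netExp_mono (L.nodeProb_nonneg n) (L.nodeProb_le_one n) fun ω => ?_
    by_cases h : (p.restrict k.le_succ).Realizes (strOf ω) a ∧
        ε * n < |extCount p (strOf ω) a - γ * n|
    · rw [Set.indicator_of_mem (by exact h), if_pos h.1, one_mul, one_mul, mul_add, ← Real.exp_add,
        ← Real.exp_add, Pi.one_apply]
      have h2 := h.2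
      rcases lt_abs.1 h2 with h3 | h3
      · have : 1 ≤ Real.exp (-(ε / 2 * (ε * n)) + ε / 2 * (extCount p (strOf ω) a - γ * n)) :=
          Real.one_le_exp (by nlinarith)
        linarith [Real.exp_pos (-(ε / 2 * (ε * n)) + -(ε / 2) * (extCount p (strOf ω) a - γ * n))]
      · have : 1 ≤ Real.exp (-(ε / 2 * (ε * n)) + -(ε / 2) * (extCount p (strOf ω) a - γ * n)) :=
          Real.one_le_exp (by nlinarith)
        linarith [Real.exp_pos (-(ε / 2 * (ε * n)) + ε / 2 * (extCount p (strOf ω) a - γ * n))]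
    · rw [Set.indicator_of_notMem (by exact h)]
      positivity
  refine hle.trans ?_
  rw [netExp_const_mul, netExp_add]
  calc _ ≤ Real.exp (-(ε / 2 * (ε * n))) * (Real.exp (ε / 2 * k + (ε / 2) ^ 2 * n)
        + Real.exp (ε / 2 * k + (ε / 2) ^ 2 * n)) := by gcongr
    _ = 2 * (Real.exp (-(ε / 2 * (ε * n))) * Real.exp (ε / 2 * k + (ε / 2) ^ 2 * n)) := by ring
    _ = 2 * (Real.exp (ε / 2 * k) * Real.exp (-(ε ^ 2 / 4 * n))) := by
        rw [← Real.exp_add, ← Real.exp_add]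
        congr 2
        ring
    _ = _ := by ring

end LocalNet

/-! ### Properties that hold with exponentially small failure probability -/

/-- Half of the decay rate is given up to absorb the constants and polynomial factors produced by
union bounds. -/
lemma eventually_const_mul_pow_mul_exp_le (C : ℝ) (k : ℕ) {c : ℝ} (hc : 0 < c) :
    ∀ᶠ n : ℕ in atTop, C * (n : ℝ) ^ k * Real.exp (-(c * n)) ≤ Real.exp (-(c / 2 * n)) := by
  have h := ((isLittleO_pow_exp_pos_mul_atTop k (half_pos hc)).const_mul_left C).comp_tendsto
    tendsto_natCast_atTop_atTop
  filter_upwards [h.bound one_pos] with n hn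
  simp only [Function.comp_apply, Real.norm_eq_abs, one_mul, Real.abs_exp] at hn
  calc C * (n : ℝ) ^ k * Real.exp (-(c * n)) ≤ Real.exp (c / 2 * n) * Real.exp (-(c * n)) := by
        gcongr
        exact (le_abs_self _).trans hn
    _ = _ := by
        rw [← Real.exp_add]
        congr 1
        ring

namespace LocalNet

open AtomicType Classical

variable {σ : Type u} {ar : σ → ℕ} {par : σ → Set σ} [Fintype σ]

/-- The filter of the properties of finite structures whose failure probability is exponentially
small in the size of the domain. -/
noncomputable def expAlmostSure (L : LocalNet ar par) : Filter (Σ n : ℕ, RelStr ar (Fin n)) where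
  sets := {X | ∃ c > 0, ∀ᶠ n : ℕ in atTop,
    L.strProb n {A | (⟨n, A⟩ : Σ n : ℕ, RelStr ar (Fin n)) ∉ X} ≤ Real.exp (-(c * n))}
  univ_sets := by
    refine ⟨1, one_pos, Eventually.of_forall fun n => ?_⟩
    have : netProb (L.nodeProb n) ∅ = 0 := by
      rw [netProb, Set.indicator_empty]
      exact (L.isNet n).netExp_const 0
    simp only [strProb, Set.mem_univ, not_true_eq_false, Set.ofPred_false, Set.preimage_empty, this]
    positivity
  sets_of_superset := by
    rintro X Y ⟨c, hc, h⟩ hXY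
    refine ⟨c, hc, h.mono fun n hn => le_trans (strProb_mono ?_) hn⟩
    exact fun A hA hX => hA (hXY hX)
  inter_sets := by
    rintro X Y ⟨c, hc, h⟩ ⟨c', hc', h'⟩
    have hm : 0 < min c c' := lt_min hc hc'
    refine ⟨min c c' / 2, by positivity, ?_⟩
    filter_upwards [h, h', eventually_const_mul_pow_mul_exp_le 2 0 hm] with n h1 h2 h3
    have hsub : {A : RelStr ar (Fin n) | (⟨n, A⟩ : Σ n : ℕ, RelStr ar (Fin n)) ∉ X ∩ Y}
        ⊆ {A | (⟨n, A⟩ : Σ n : ℕ, RelStr ar (Fin n)) ∉ X}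
          ∪ {A | (⟨n, A⟩ : Σ n : ℕ, RelStr ar (Fin n)) ∉ Y} := by
      intro A hA
      by_contra h
      simp only [Set.mem_union, Set.mem_ofPred_eq, not_or, not_not] at h
      exact hA h
    have e1 : Real.exp (-(c * n)) ≤ Real.exp (-(min c c' * n)) := by
      gcongr; exact min_le_left _ _
    have e2 : Real.exp (-(c' * n)) ≤ Real.exp (-(min c c' * n)) := by
      gcongr; exact min_le_right _ _
    have := (strProb_mono (L := L) hsub).trans (strProb_union_le _ _)
    simp only [pow_zero, mul_one] at h3
    linarith

variable {L : LocalNet ar par}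

lemma eventually_expAlmostSure {P : (Σ n : ℕ, RelStr ar (Fin n)) → Prop} :
    (∀ᶠ X in L.expAlmostSure, P X) ↔ ∃ c > 0, ∀ᶠ n : ℕ in atTop,
      L.strProb n {A | ¬ P ⟨n, A⟩} ≤ Real.exp (-(c * n)) := Iff.rfl

/-- There are only `n ^ k` tuples, and a polynomial factor does not harm an exponential bound. -/
lemma eventually_forall_tuple {k : ℕ} (P : (X : Σ n : ℕ, RelStr ar (Fin n)) → (Fin k → Fin X.1) → Prop)
    {C c : ℝ} (hc : 0 < c)
    (h : ∀ n (a : Fin k → Fin n), L.strProb n {A | ¬ P ⟨n, A⟩ a} ≤ C * Real.exp (-(c * n))) :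
    ∀ᶠ X in L.expAlmostSure, ∀ a, P X a := by
  rw [eventually_expAlmostSure]
  refine ⟨c / 2, half_pos hc, ?_⟩
  filter_upwards [eventually_const_mul_pow_mul_exp_le C k hc] with n hn
  refine le_trans ?_ hn
  have hU : {A : RelStr ar (Fin n) | ¬ ∀ a, P ⟨n, A⟩ a} = ⋃ a : Fin k → Fin n, {A | ¬ P ⟨n, A⟩ a} := by
    ext A
    simp
  rw [hU, strProb, Set.preimage_iUnion]
  refine (netProb_iUnion_le (L.nodeProb_nonneg n) (L.nodeProb_le_one n) _).trans ?_
  refine (Finset.sum_le_card_nsmul _ _ _ fun a _ => h n a).trans ?_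
  simp only [Finset.card_univ, Fintype.card_fun, Fintype.card_fin, nsmul_eq_mul, Nat.cast_pow]
  exact le_of_eq (by ring)

lemma tendsto_fst_expAlmostSure : Tendsto Sigma.fst L.expAlmostSure atTop := by
  rw [tendsto_atTop]
  intro m
  rw [eventually_expAlmostSure]
  refine ⟨1, one_pos, (eventually_ge_atTop m).mono fun n hn => ?_⟩
  have : {A : RelStr ar (Fin n) | ¬ m ≤ n} = ∅ := by ext; simp [hn]
  simp only [this, strProb, Set.preimage_empty]
  rw [netProb, Set.indicator_empty]
  exact ((L.isNet n).netExp_const 0).le.trans (Real.exp_pos _).le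

end LocalNet

/-! ### Generic limits -/

/-- Along the filter `F` of finite structures, every tuple realizing an atomic type `q` of positive
probability has asymptotically `n v(p) / v(q)` extensions, by a new element, that realize `p ⊇ q`. -/
structure GenericLimit {σ : Type u} {ar : σ → ℕ} (F : Filter (Σ n : ℕ, RelStr ar (Fin n)))
    (S : Set σ) (v : ∀ k, AtomicType ar S k → ℝ) : Prop where
  nonneg : ∀ k p, 0 ≤ v k p
  le_restrict : ∀ k p, v (k + 1) p ≤ v k (p.restrict k.le_succ)
  tendsto_fst : Tendsto Sigma.fst F atTop
  not_realizes : ∀ k p, v k p = 0 → ∀ᶠ X in F, ∀ a : Fin k → Fin X.1, ¬ p.Realizes X.2 a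
  eq_restrict : ∀ k p, (∃ i : Fin k, p.ident i.castSucc (Fin.last k)) →
    v (k + 1) p = v k (p.restrict k.le_succ)
  abs_extCount_sub_le : ∀ k p, (∀ i : Fin k, ¬ p.ident i.castSucc (Fin.last k)) →
    0 < v k (p.restrict k.le_succ) → ∀ ε > 0, ∀ᶠ X in F, ∀ a : Fin k → Fin X.1,
      (p.restrict k.le_succ).Realizes X.2 a →
      |LocalNet.extCount p X.2 a - v (k + 1) p / v k (p.restrict k.le_succ) * X.1| ≤ ε * X.1

namespace LocalNet

open AtomicType Classical

variable {σ : Type u} {ar : σ → ℕ} {par : σ → Set σ} [Fintype σ] {L : LocalNet ar par} {S : Set σ}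

/-- The interface between probability and counting: quantifier elimination uses local networks only
through these properties. -/
theorem genericLimit (hS : ∀ R ∈ S, par R ⊆ S) :
    GenericLimit L.expAlmostSure S (fun _ p => L.typeProb p) where
  nonneg := fun _ p => typeProb_nonneg p
  le_restrict := fun k p => typeProb_le_restrict hS k.le_succ p
  tendsto_fst := tendsto_fst_expAlmostSure
  not_realizes := by
    intro k p hp
    refine eventually_forall_tuple (fun X a => ¬ p.Realizes X.2 a) (C := 0) one_pos fun n a => ?_
    simp only [not_not, zero_mul]
    by_cases ha : Setoid.ker a = p.ident
    · exact ((strProb_realizes hS p ha).trans hp).le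
    · have : {A : RelStr ar (Fin n) | p.Realizes A a} = ∅ := by
        ext A
        simp only [Set.mem_ofPred_eq, Set.mem_empty_iff_false, iff_false]
        exact fun h => ha h.1
      rw [this, strProb, Set.preimage_empty, netProb, Set.indicator_empty]
      exact ((L.isNet n).netExp_const 0).le
  eq_restrict := by
    rintro k p ⟨i, hi⟩
    refine le_antisymm (typeProb_le_restrict hS k.le_succ p) ?_
    set a : Fin k → Fin (k + 1) := fun j => p.rep j.castSucc with ha
    have hker : Setoid.ker a = (p.restrict k.le_succ).ident := by
      show Setoid.comap Fin.castSucc (Setoid.ker p.rep) = _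
      rw [p.ker_rep]
      rfl
    rw [← strProb_realizes hS _ hker]
    refine strProb_mono fun A hA => ?_
    have h := (realizes_snoc_of_ident hi hA (a i)).2 rfl
    have : (Fin.snoc (α := fun _ => Fin (k + 1)) a (a i) : Fin (k + 1) → Fin (k + 1)) = p.rep := by
      funext j
      refine Fin.lastCases ?_ (fun j => ?_) j
      · rw [Fin.snoc_last]
        have : Setoid.ker p.rep i.castSucc (Fin.last k) := p.ker_rep ▸ hi
        exact this
      · rw [Fin.snoc_castSucc]
    rw [this] at h
    exact h
  abs_extCount_sub_le := by
    intro k p hp hq ε hε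
    -- The concentration bound requires a deviation of at most 1.
    set δ := min ε 1 with hδ
    have hδ0 : 0 < δ := lt_min hε one_pos
    refine eventually_forall_tuple (fun X a => (p.restrict k.le_succ).Realizes X.2 a →
      |extCount p X.2 a - L.typeProb p / L.typeProb (p.restrict k.le_succ) * X.1| ≤ ε * X.1)
      (C := 2 * Real.exp (δ / 2 * k)) (c := δ ^ 2 / 4) (by positivity) fun n a => ?_
    refine le_trans (strProb_mono fun A hA => ?_)
      (strProb_extCount_le hS hp hq a hδ0 (min_le_right _ _))
    simp only [Set.mem_ofPred_eq, Classical.not_imp, not_le] at hA ⊢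
    refine ⟨hA.1, lt_of_le_of_lt ?_ hA.2⟩
    gcongr
    exact min_le_left _ _

end LocalNet

/-! ### Counting realizations -/

section Counting

open AtomicType Classical

variable {σ : Type u} {ar : σ → ℕ} {S : Set σ}

lemma ncard_setOf_mem_finset {β γ : Type*} [Finite β] (f : β → γ) (W : Finset γ) :
    {b | f b ∈ W}.ncard = ∑ p ∈ W, {b | f b = p}.ncard := by
  have := Fintype.ofFinite β
  simp only [Set.ncard_eq_toFinset_card']
  rw [Finset.card_eq_sum_card_fiberwise (f := f) (t := W) (by intro b; simp)]
  refine Finset.sum_congr rfl fun p hp => ?_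
  congr 1
  ext b
  simp only [Finset.mem_filter, Set.mem_toFinset, Set.mem_ofPred_eq]
  exact ⟨fun h => h.2, fun h => ⟨h ▸ hp, h⟩⟩

/-- The number of `b` such that `(a, b)` realizes `p`. -/
noncomputable def tupleCount {k e n : ℕ} (p : AtomicType ar S (k + e)) (A : RelStr ar (Fin n))
    (a : Fin k → Fin n) : ℕ :=
  {b : Fin e → Fin n | p.Realizes A (Fin.append a b)}.ncard

lemma tupleCount_succ {k e n : ℕ} (p : AtomicType ar S (k + (e + 1))) (A : RelStr ar (Fin n))
    (a : Fin k → Fin n) :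
    tupleCount p A a = ∑ b : Fin e → Fin n with
      AtomicType.Realizes (p.restrict (k + e).le_succ) A (Fin.append a b),
      LocalNet.extCount (k := k + e) p A (Fin.append a b) := by
  unfold tupleCount LocalNet.extCount
  simp only [Set.ncard_eq_toFinset_card']
  rw [Finset.card_eq_sum_card_fiberwise (f := fun b : Fin (e + 1) → Fin n => Fin.init b)
    (t := Finset.univ.filter fun b : Fin e → Fin n =>
      AtomicType.Realizes (p.restrict (k + e).le_succ) A (Fin.append a b))]
  · refine Finset.sum_congr rfl fun b _ => ?_
    refine (Finset.card_bij (fun x _ => Fin.snoc (α := fun _ => Fin n) b x) ?_ ?_ ?_).symm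
    · intro x hx
      simp only [Set.mem_toFinset, Set.mem_ofPred_eq, Finset.mem_filter, Fin.init_snoc, and_true] at hx ⊢
      rw [Fin.append_snoc]
      exact hx
    · intro x _ y _ h
      simpa using congrFun h (Fin.last e)
    · intro c hc
      simp only [Set.mem_toFinset, Set.mem_ofPred_eq, Finset.mem_filter] at hc ⊢
      obtain ⟨h1, rfl⟩ := hc
      refine ⟨c (Fin.last e), ?_, Fin.snoc_init_self c⟩
      rw [← Fin.append_snoc, Fin.snoc_init_self]
      exact h1
  · intro c hc
    simp only [Set.mem_ofPred_eq, Finset.coe_filter, Finset.mem_univ, true_and,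
      Set.coe_toFinset] at hc ⊢
    have h := hc.restrict (k + e).le_succ
    convert h using 1
    funext i
    conv_rhs => rw [← Fin.snoc_init_self c, Fin.append_snoc]
    exact (Fin.snoc_castSucc (α := fun _ => Fin n) _ _ i).symm

/-- Composition of two approximate counts: about `g1 * D` objects, each with about `g2 * n`
extensions on average. -/
lemma abs_sub_mul_le {N N' D n g1 g2 ε1 ε2 : ℝ} (hn : 0 ≤ n) (hg2 : 0 ≤ g2)
    (hε2 : 0 ≤ ε2) (h : |N - g2 * n * N'| ≤ ε2 * n * N') (h' : |N' - g1 * D| ≤ ε1 * D) :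
    |N - g1 * g2 * (D * n)| ≤ (ε2 * (g1 + ε1) + g2 * ε1) * (D * n) := by
  have e1 : N' ≤ (g1 + ε1) * D := by linarith [(abs_le.1 h').2]
  have e2 : ε2 * n * N' ≤ ε2 * n * ((g1 + ε1) * D) :=
    mul_le_mul_of_nonneg_left e1 (mul_nonneg hε2 hn)
  have e3 : |g2 * n * (N' - g1 * D)| ≤ g2 * n * (ε1 * D) := by
    rw [abs_mul, abs_of_nonneg (mul_nonneg hg2 hn)]
    exact mul_le_mul_of_nonneg_left h' (mul_nonneg hg2 hn)
  calc |N - g1 * g2 * (D * n)| = |(N - g2 * n * N') + g2 * n * (N' - g1 * D)| := by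
        congr 1; ring
    _ ≤ |N - g2 * n * N'| + |g2 * n * (N' - g1 * D)| := abs_add_le _ _
    _ ≤ ε2 * n * ((g1 + ε1) * D) + g2 * n * (ε1 * D) := add_le_add (h.trans e2) e3
    _ = _ := by ring

variable {F : Filter (Σ n : ℕ, RelStr ar (Fin n))} {v : ∀ k, AtomicType ar S k → ℝ}

/-- Induction on `e`. An identified variable leaves the count unchanged, a new one multiplies it by
about `n v(p) / v(p')`, and the ratios telescope. So `d` counts the new elements, except when `v(p')
= 0`: then `p` is almost surely not realized and any `d` serves. -/
theorem GenericLimit.exists_abs_tupleCount_sub_le (hF : GenericLimit F S v) {k : ℕ} (e : ℕ)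
    (p : AtomicType ar S (k + e)) (hq : 0 < v k (p.restrict (Nat.le_add_right k e))) :
    ∃ d : ℕ, ∀ ε > 0, ∀ᶠ X in F, ∀ a : Fin k → Fin X.1,
      (p.restrict (Nat.le_add_right k e)).Realizes X.2 a →
      |tupleCount p X.2 a - v (k + e) p / v k (p.restrict (Nat.le_add_right k e)) * (X.1 : ℝ) ^ d|
        ≤ ε * (X.1 : ℝ) ^ d := by
  induction e with
  | zero =>
    refine ⟨0, fun ε hε => Eventually.of_forall fun X a ha => ?_⟩
    have h1 : v (k + 0) p / v k (p.restrict (Nat.le_add_right k 0)) = 1 := div_self hq.ne'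
    have h2 : tupleCount p X.2 a = 1 := by
      unfold tupleCount
      rw [Set.ncard_eq_one]
      refine ⟨Fin.elim0, ?_⟩
      ext b
      have hb : Fin.append a b = a := by
        rw [Fin.append_right_nil _ _ rfl]; rfl
      simp only [Set.mem_ofPred_eq, Set.mem_singleton_iff, hb]
      exact iff_of_true ha (Subsingleton.elim _ _)
    rw [h1, h2]
    simpa using hε.le
  | succ e ih =>
    set q := p.restrict (Nat.le_add_right k (e + 1)) with hqdef
    set p' : AtomicType ar S (k + e) := AtomicType.restrict (k := k + e + 1) p (k + e).le_succ with hp'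
    have hrestr : ∀ {n : ℕ} {A : RelStr ar (Fin n)} {a : Fin k → Fin n} {b : Fin e → Fin n},
        p'.Realizes A (Fin.append a b) → q.Realizes A a := by
      intro n A a b h
      have h1 : q.Realizes A (fun i => Fin.append a b (Fin.castLE (Nat.le_add_right k e) i)) :=
        h.restrict (Nat.le_add_right k e)
      have h2 : (fun i => Fin.append a b (Fin.castLE (Nat.le_add_right k e) i)) = a :=
        funext fun i => Fin.append_left a b i
      rwa [h2] at h1
    rcases (hF.nonneg _ p').eq_or_lt with h0 | h0
    · have hp0 : v (k + (e + 1)) p = 0 :=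
        le_antisymm ((hF.le_restrict (k + e) p).trans h0.symm.le) (hF.nonneg _ p)
      refine ⟨0, fun ε hε => (hF.not_realizes _ p hp0).mono fun X hX a _ => ?_⟩
      have : tupleCount p X.2 a = 0 := by
        rw [tupleCount, Set.ncard_eq_zero]
        ext b
        simp [hX]
      rw [this, hp0]
      simpa using hε.le
    · obtain ⟨d, hd⟩ := ih p' hq
      by_cases hid : ∃ i : Fin (k + e), p.ident i.castSucc (Fin.last (k + e))
      · refine ⟨d, fun ε hε => (hd ε hε).mono fun X hX a ha => ?_⟩
        have h1 : v (k + (e + 1)) p = v (k + e) p' := hF.eq_restrict (k + e) p hid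
        have h2 : tupleCount p X.2 a = tupleCount p' X.2 a := by
          rw [tupleCount_succ]
          have : ∀ b ∈ Finset.univ.filter fun b : Fin e → Fin X.1 => p'.Realizes X.2 (Fin.append a b),
              LocalNet.extCount (k := k + e) p X.2 (Fin.append a b) = 1 := by
            intro b hb
            obtain ⟨i, hi⟩ := hid
            unfold LocalNet.extCount
            rw [Set.ncard_eq_one]
            refine ⟨Fin.append a b i, ?_⟩
            ext x
            exact realizes_snoc_of_ident hi (Finset.mem_filter.1 hb).2 x
          rw [Finset.sum_congr rfl this, tupleCount, Set.ncard_eq_toFinset_card']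
          simp
        rw [h1, h2]
        exact hX a ha
      · push Not at hid
        refine ⟨d + 1, fun ε hε => ?_⟩
        set g1 := v (k + e) p' / v k q with hg1
        set g2 := v (k + (e + 1)) p / v (k + e) p' with hg2
        have hg1' : 0 ≤ g1 := div_nonneg (hF.nonneg _ _) hq.le
        have hg2' : 0 ≤ g2 := div_nonneg (hF.nonneg _ _) h0.le
        have hg : v (k + (e + 1)) p / v k q = g1 * g2 := by
          rw [hg1, hg2]; field_simp
        -- Chosen so that each of the two error terms `ε2 * (g1 + ε1)` and `g2 * ε1` is at most `ε /
        -- 2`; the bound `ε1 ≤ 1` decouples them.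
        set ε1 := min 1 (ε / (2 * (g2 + 1))) with hε1
        set ε2 := ε / (2 * (g1 + 1)) with hε2
        have hε1' : 0 < ε1 := lt_min one_pos (by positivity)
        have hε2' : 0 < ε2 := by positivity
        have hbound : ε2 * (g1 + ε1) + g2 * ε1 ≤ ε := by
          have b1 : ε2 * (g1 + ε1) ≤ ε / 2 := by
            calc ε2 * (g1 + ε1) ≤ ε2 * (g1 + 1) := by
                  gcongr; exact min_le_left _ _
              _ = ε / 2 := by rw [hε2]; field_simp
          have b2 : g2 * ε1 ≤ ε / 2 := by
            calc g2 * ε1 ≤ (g2 + 1) * (ε / (2 * (g2 + 1))) := by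
                  gcongr
                  · linarith
                  · exact min_le_right _ _
              _ = ε / 2 := by field_simp
          linarith
        filter_upwards [hd ε1 hε1', hF.abs_extCount_sub_le (k + e) p hid h0 ε2 hε2'] with X h1 h2 a ha
        have h3 : |(tupleCount p X.2 a : ℝ) - g2 * X.1 * tupleCount p' X.2 a|
            ≤ ε2 * X.1 * tupleCount p' X.2 a := by
          have hc : (tupleCount p' X.2 a : ℝ)
              = ∑ b : Fin e → Fin X.1 with p'.Realizes X.2 (Fin.append a b), (1 : ℝ) := by
            rw [tupleCount, Set.ncard_eq_toFinset_card']
            simp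
          rw [tupleCount_succ, hc, Nat.cast_sum, Finset.mul_sum, Finset.mul_sum,
            ← Finset.sum_sub_distrib]
          refine (Finset.abs_sum_le_sum_abs _ _).trans (Finset.sum_le_sum fun b hb => ?_)
          rw [mul_one, mul_one]
          exact h2 _ (Finset.mem_filter.1 hb).2
        rw [hg, pow_succ]
        refine (abs_sub_mul_le (Nat.cast_nonneg _) hg2' hε2'.le h3 (h1 a ha)).trans ?_
        exact mul_le_mul_of_nonneg_right hbound (by positivity)

/-- The filter on the tuples realizing `q` induced by a filter on structures. -/
def tuples (F : Filter (Σ n : ℕ, RelStr ar (Fin n))) {k : ℕ} (q : AtomicType ar S k) :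
    Filter (Σ X : (Σ n : ℕ, RelStr ar (Fin n)), (Fin k → Fin X.1)) :=
  comap Sigma.fst F ⊓ 𝓟 {Y | q.Realizes Y.1.2 Y.2}

lemma eventually_tuples {k : ℕ} {q : AtomicType ar S k}
    {P : (Σ X : (Σ n : ℕ, RelStr ar (Fin n)), (Fin k → Fin X.1)) → Prop} :
    (∀ᶠ Y in tuples F q, P Y)
      ↔ ∀ᶠ X in F, ∀ a : Fin k → Fin X.1, q.Realizes X.2 a → P ⟨X, a⟩ := by
  rw [tuples, eventually_inf_principal, eventually_comap]
  refine eventually_congr (Eventually.of_forall fun X => ⟨fun h a => h ⟨X, a⟩ rfl, ?_⟩)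
  rintro h ⟨_, a⟩ rfl
  exact h a

lemma GenericLimit.tendsto_size (hF : GenericLimit F S v) {k : ℕ} (q : AtomicType ar S k) :
    Tendsto (fun Y => (Y.1.1 : ℝ)) (tuples F q) atTop :=
  tendsto_natCast_atTop_atTop.comp (hF.tendsto_fst.comp (tendsto_comap.mono_left inf_le_left))

theorem GenericLimit.exists_tendsto_tupleCount (hF : GenericLimit F S v) {k : ℕ} (e : ℕ)
    {q : AtomicType ar S k} (hq : 0 < v k q) (p : AtomicType ar S (k + e))
    (hpq : p.restrict (Nat.le_add_right k e) = q) :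
    ∃ d : ℕ, Tendsto (fun Y => (tupleCount p Y.1.2 Y.2 : ℝ) / (Y.1.1 : ℝ) ^ d) (tuples F q)
      (𝓝 (v (k + e) p / v k q)) := by
  subst hpq
  obtain ⟨d, hd⟩ := hF.exists_abs_tupleCount_sub_le e p hq
  refine ⟨d, Metric.tendsto_nhds.2 fun ε hε => ?_⟩
  have h1 : ∀ᶠ Y in tuples F (p.restrict (Nat.le_add_right k e)),
      |tupleCount p Y.1.2 Y.2 - v (k + e) p / v k (p.restrict (Nat.le_add_right k e))
        * (Y.1.1 : ℝ) ^ d| ≤ ε / 2 * (Y.1.1 : ℝ) ^ d :=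
    eventually_tuples.2 (hd (ε / 2) (half_pos hε))
  filter_upwards [h1, (hF.tendsto_size _).eventually_gt_atTop 0] with Y hY hpos
  have hpos' : 0 < (Y.1.1 : ℝ) ^ d := pow_pos hpos d
  rw [Real.dist_eq]
  refine lt_of_le_of_lt ?_ (half_lt_self hε)
  rw [div_sub' hpos'.ne', abs_div, abs_of_pos hpos', div_le_iff₀ hpos', mul_comm (_ ^ d)]
  exact hY

/-- After division by `n ^ D`, the types of degree below `D` contribute nothing in the limit. -/
theorem GenericLimit.tendsto_ncard_types (hF : GenericLimit F S v) {k e : ℕ}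
    {q : AtomicType ar S k} (d : AtomicType ar S (k + e) → ℕ) {D : ℕ}
    {W : Finset (AtomicType ar S (k + e))} (hD : ∀ p ∈ W, d p ≤ D)
    (hd : ∀ p ∈ W, Tendsto (fun Y => (tupleCount p Y.1.2 Y.2 : ℝ) / (Y.1.1 : ℝ) ^ d p) (tuples F q)
      (𝓝 (v (k + e) p / v k q))) :
    Tendsto (fun Y => ({b : Fin e → Fin Y.1.1 | typeOf S Y.1.2 (Fin.append Y.2 b) ∈ W}.ncard : ℝ)
        / (Y.1.1 : ℝ) ^ D) (tuples F q) (𝓝 (∑ p ∈ W with d p = D, v (k + e) p / v k q)) := by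
  have h1 : ∀ Y : (Σ X : (Σ n : ℕ, RelStr ar (Fin n)), (Fin k → Fin X.1)),
      ({b : Fin e → Fin Y.1.1 | typeOf S Y.1.2 (Fin.append Y.2 b) ∈ W}.ncard : ℝ) / (Y.1.1 : ℝ) ^ D
      = ∑ p ∈ W, (tupleCount p Y.1.2 Y.2 : ℝ) / (Y.1.1 : ℝ) ^ D := by
    intro Y
    rw [ncard_setOf_mem_finset, Nat.cast_sum, Finset.sum_div]
    simp only [tupleCount, realizes_iff_typeOf_eq]
  simp only [h1]
  rw [Finset.sum_filter]
  refine tendsto_finsetSum _ fun p hp => ?_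
  split_ifs with h
  · rw [← h]
    exact hd p hp
  · have hlt : d p < D := lt_of_le_of_ne (hD p hp) h
    have h2 : Tendsto (fun Y : (Σ X : (Σ n : ℕ, RelStr ar (Fin n)), (Fin k → Fin X.1)) =>
        ((Y.1.1 : ℝ) ^ (D - d p))⁻¹) (tuples F q) (𝓝 0) :=
      tendsto_inv_atTop_zero.comp
        ((tendsto_pow_atTop (by omega)).comp (hF.tendsto_size q))
    have h3 := (hd p hp).mul h2
    rw [mul_zero] at h3
    refine h3.congr fun Y => ?_
    rw [div_mul_eq_mul_div, mul_comm, div_eq_mul_inv, div_eq_mul_inv, mul_comm (_⁻¹), mul_assoc,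
      ← mul_inv, ← pow_add, Nat.sub_add_cancel hlt.le]

end Counting

/-! ### Almost sure elimination of quantifiers -/

/-- This is where noncriticality acts: convergence settles the sign of a quantity as soon as its
limit is nonzero. -/
lemma exists_eventually_nonneg_iff {β : Type*} {f : Filter β} {h : β → ℝ} {c : ℝ}
    (hh : Tendsto h f (𝓝 c)) (hc : c ≠ 0) : ∃ b : Prop, ∀ᶠ y in f, (0 ≤ h y ↔ b) := by
  rcases hc.lt_or_gt with hc | hc
  · refine ⟨False, (hh.eventually_lt_const hc).mono fun y hy => ?_⟩
    simpa using hy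
  · exact ⟨True, (hh.eventually_const_lt hc).mono fun y hy => iff_true_intro hy.le⟩

section QuantifierElimination

open AtomicType Classical

variable {σ : Type u} [Finite σ] {ar : σ → ℕ} {S : Set σ}
  {F : Filter (Σ n : ℕ, RelStr ar (Fin n))} {v : ∀ k, AtomicType ar S k → ℝ}

/-- A property of tuples that is almost surely determined by every type of positive probability is
almost surely a property of the type. -/
lemma GenericLimit.exists_set_types (hF : GenericLimit F S v) {k : ℕ}
    {P : (X : Σ n : ℕ, RelStr ar (Fin n)) → (Fin k → Fin X.1) → Prop}
    (h : ∀ q : AtomicType ar S k, 0 < v k q →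
      ∃ b : Prop, ∀ᶠ Y in tuples F q, (P Y.1 Y.2 ↔ b)) :
    ∃ T : Set (AtomicType ar S k), ∀ᶠ X in F, ∀ a, P X a ↔ typeOf S X.2 a ∈ T := by
  -- A type of probability zero is almost surely not realized, so either truth value can be assigned
  -- to it.
  have h' : ∀ q : AtomicType ar S k, ∃ b : Prop, ∀ᶠ Y in tuples F q, (P Y.1 Y.2 ↔ b) := by
    intro q
    rcases (hF.nonneg k q).eq_or_lt with h0 | h0
    · refine ⟨True, ?_⟩
      rw [eventually_tuples]
      exact (hF.not_realizes k q h0.symm).mono fun X hX a ha => absurd ha (hX a)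
    · exact h q h0
  choose b hb using h'
  refine ⟨{q | b q}, ?_⟩
  have := eventually_all.2 fun q => eventually_tuples.1 (hb q)
  filter_upwards [this] with X hX a
  exact hX _ a ((realizes_iff_typeOf_eq _ _ _).2 rfl)

variable {C : ℝ → Prop} {l : ℕ}

/-- Conditional on a type `q` of positive probability, the extensions satisfying `Ψ` almost surely do
not exist, or almost surely exist and then all proportions among them converge. -/
theorem GenericLimit.eventually_empty_or_tendsto_proportion (hF : GenericLimit F S v) (hC0 : C 0)
    (hC : ∀ (k e : ℕ) (q : AtomicType ar S k) (T U : Finset (AtomicType ar S (k + e))),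
      k + e ≤ l → 0 < v k q → T.Nonempty → T ⊆ U →
      (∀ p ∈ U, p.restrict (Nat.le_add_right k e) = q) → 0 < ∑ p ∈ U, v (k + e) p / v k q →
      C ((∑ p ∈ T, v (k + e) p / v k q) / ∑ p ∈ U, v (k + e) p / v k q))
    {k e : ℕ} (hl : k + e ≤ l) {q : AtomicType ar S k} (hq : 0 < v k q)
    {Ψ : (X : Σ n : ℕ, RelStr ar (Fin n)) → (Fin (k + e) → Fin X.1) → Prop}
    {TΨ : Set (AtomicType ar S (k + e))}
    (hΨ : ∀ᶠ X in F, ∀ c, Ψ X c ↔ typeOf S X.2 c ∈ TΨ) :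
    (∀ᶠ Y in tuples F q, ¬ {b : Fin e → Fin Y.1.1 | Ψ Y.1 (Fin.append Y.2 b)}.Nonempty) ∨
    ((∀ᶠ Y in tuples F q, {b : Fin e → Fin Y.1.1 | Ψ Y.1 (Fin.append Y.2 b)}.Nonempty) ∧
      ∀ (Φ : (X : Σ n : ℕ, RelStr ar (Fin n)) → (Fin (k + e) → Fin X.1) → Prop)
        (TΦ : Set (AtomicType ar S (k + e))),
        (∀ᶠ X in F, ∀ c, Φ X c ↔ typeOf S X.2 c ∈ TΦ) → ∃ α, C α ∧
          Tendsto (fun Y => proportion {b : Fin e → Fin Y.1.1 | Φ Y.1 (Fin.append Y.2 b)}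
            {b : Fin e → Fin Y.1.1 | Ψ Y.1 (Fin.append Y.2 b)}) (tuples F q) (𝓝 α)) := by
  have := Fintype.ofFinite (AtomicType ar S (k + e))
  -- Almost surely only types of positive probability occur, so `U` describes exactly the extensions
  -- satisfying `Ψ`. Whether `U` is empty decides between the two alternatives.
  set U : Finset (AtomicType ar S (k + e)) := Finset.univ.filter fun p =>
    p ∈ TΨ ∧ p.restrict (Nat.le_add_right k e) = q ∧ 0 < v (k + e) p with hU
  have hmemU : ∀ p, p ∈ U ↔ p ∈ TΨ ∧ p.restrict (Nat.le_add_right k e) = q ∧ 0 < v (k + e) p := by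
    simp [hU]
  have hpos : ∀ᶠ Y in tuples F q, ∀ b : Fin e → Fin Y.1.1,
      0 < v (k + e) (typeOf S Y.1.2 (Fin.append Y.2 b)) := by
    rw [eventually_tuples]
    have h1 : ∀ᶠ X in F, ∀ p : AtomicType ar S (k + e), v (k + e) p = 0 →
        ∀ a : Fin (k + e) → Fin X.1, ¬ p.Realizes X.2 a := by
      rw [eventually_all]
      intro p
      by_cases hp : v (k + e) p = 0
      · exact (hF.not_realizes _ p hp).mono fun X hX _ => hX
      · exact Eventually.of_forall fun X h => absurd h hp
    filter_upwards [h1] with X hX a _ b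
    refine (hF.nonneg _ _).lt_of_ne' fun h0 => ?_
    exact hX _ h0 _ ((realizes_iff_typeOf_eq _ _ _).2 rfl)
  have hrest : ∀ᶠ Y in tuples F q, ∀ b : Fin e → Fin Y.1.1,
      (typeOf S Y.1.2 (Fin.append Y.2 b)).restrict (Nat.le_add_right k e) = q := by
    rw [eventually_tuples]
    refine Eventually.of_forall fun X a ha b => ?_
    rw [typeOf_restrict, ← realizes_iff_typeOf_eq]
    have h2 : (fun i => Fin.append a b (Fin.castLE (Nat.le_add_right k e) i)) = a :=
      funext fun i => Fin.append_left a b i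
    rwa [h2]
  have hset : ∀ᶠ Y in tuples F q, {b : Fin e → Fin Y.1.1 | Ψ Y.1 (Fin.append Y.2 b)}
      = {b | typeOf S Y.1.2 (Fin.append Y.2 b) ∈ U} := by
    have h1 : ∀ᶠ Y in tuples F q, ∀ c, Ψ Y.1 c ↔ typeOf S Y.1.2 c ∈ TΨ :=
      eventually_tuples.2 (hΨ.mono fun X hX _ _ => hX)
    filter_upwards [hpos, hrest, h1] with Y h2 h3 h4
    ext b
    simp only [Set.mem_ofPred_eq, hmemU, h4, h3 b, h2 b, and_true]
  rcases U.eq_empty_or_nonempty with hUe | hUne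
  · left
    filter_upwards [hset] with Y hY
    rw [hY, hUe]
    simp
  right
  have hex : ∀ p : AtomicType ar S (k + e), ∃ d : ℕ, p.restrict (Nat.le_add_right k e) = q →
      Tendsto (fun Y => (tupleCount p Y.1.2 Y.2 : ℝ) / (Y.1.1 : ℝ) ^ d) (tuples F q)
        (𝓝 (v (k + e) p / v k q)) := by
    intro p
    by_cases hp : p.restrict (Nat.le_add_right k e) = q
    · obtain ⟨d, hd⟩ := hF.exists_tendsto_tupleCount e hq p hp
      exact ⟨d, fun _ => hd⟩
    · exact ⟨0, fun h => absurd h hp⟩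
  choose d hd using hex
  -- The dominant degree. It is attained in `U`, so the limit of the normalized count is positive
  -- and can serve as a denominator.
  set D := U.sup d with hD
  have hle : ∀ p ∈ U, d p ≤ D := fun p hp => Finset.le_sup hp
  have hlimU := hF.tendsto_ncard_types d hle (fun p hp => hd p ((hmemU p).1 hp).2.1)
  set U0 := U.filter fun p => d p = D with hU0
  have hU0ne : U0.Nonempty := by
    obtain ⟨p, hp, hpD⟩ := Finset.exists_mem_eq_sup U hUne d
    exact ⟨p, Finset.mem_filter.2 ⟨hp, hpD.symm⟩⟩
  have hU0pos : 0 < ∑ p ∈ U0, v (k + e) p / v k q :=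
    Finset.sum_pos (fun p hp => div_pos ((hmemU p).1 (Finset.mem_filter.1 hp).1).2.2 hq) hU0ne
  constructor
  · filter_upwards [hset, hlimU.eventually_const_lt hU0pos] with Y h1 h2
    rw [h1]
    by_contra h3
    rw [Set.not_nonempty_iff_eq_empty.1 h3] at h2
    simp at h2
  · intro Φ TΦ hΦ
    set V := U.filter fun p => p ∈ TΦ with hV
    have hVU : V ⊆ U := Finset.filter_subset _ _
    have hlimV := hF.tendsto_ncard_types d (W := V) (fun p hp => hle p (hVU hp))
      (fun p hp => hd p ((hmemU p).1 (hVU hp)).2.1)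
    set V0 := V.filter fun p => d p = D with hV0
    refine ⟨_, ?_, (hlimV.div hlimU hU0pos.ne').congr' ?_⟩
    -- If no type of dominant degree satisfies `Φ`, the limit is 0, which `hC` does not cover
    -- because it requires `T` to be nonempty.
    · rcases V0.eq_empty_or_nonempty with h0 | h0
      · rw [h0]
        simpa using hC0
      · exact hC k e q V0 U0 hl hq h0 (Finset.filter_subset_filter _ hVU)
          (fun p hp => ((hmemU p).1 (Finset.mem_filter.1 hp).1).2.1) hU0pos
    · have h1 : ∀ᶠ Y in tuples F q, ∀ c, Φ Y.1 c ↔ typeOf S Y.1.2 c ∈ TΦ :=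
        eventually_tuples.2 (hΦ.mono fun X hX _ _ => hX)
      filter_upwards [h1, hset, (hF.tendsto_size q).eventually_gt_atTop 0] with Y h2 h3 h4
      rw [proportion, h3, Pi.div_apply, div_div_div_cancel_right₀ (pow_pos h4 D).ne']
      congr 3
      ext b
      simp only [hV, Finset.mem_filter, Set.mem_inter_iff, Set.mem_ofPred_eq, h2, and_comm]

/-- Along a generic limit, a formula whose thresholds avoid the differences of critical numbers is
almost surely equivalent to a quantifier-free formula. -/
theorem GenericLimit.exists_types (hF : GenericLimit F S v) (hC0 : C 0)
    (hC : ∀ (k e : ℕ) (q : AtomicType ar S k) (T U : Finset (AtomicType ar S (k + e))),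
      k + e ≤ l → 0 < v k q → T.Nonempty → T ⊆ U →
      (∀ p ∈ U, p.restrict (Nat.le_add_right k e) = q) → 0 < ∑ p ∈ U, v (k + e) p / v k q →
      C ((∑ p ∈ T, v (k + e) p / v k q) / ∑ p ∈ U, v (k + e) p / v k q))
    {k : ℕ} (φ : CPL ar k) (hS : φ.symbols ⊆ S) (hl : k + φ.qr ≤ l)
    (hr : ∀ r ∈ φ.thresholds, ∀ α β, C α → C β → r ≠ α - β) :
    ∃ T : Set (AtomicType ar S k), ∀ᶠ X in F, ∀ a, φ.Sat X.2 a ↔ typeOf S X.2 a ∈ T := by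
  -- The budget `l` stays fixed: binding `e` variables moves `e` from the quantifier rank to the
  -- number of free variables. Hence one set `C` of critical numbers serves all thresholds of the
  -- formula.
  induction φ with
  | top => exact ⟨Set.univ, Eventually.of_forall fun X a => by simp [CPL.Sat]⟩
  | eq i j => exact ⟨{p | p.ident i j}, Eventually.of_forall fun X a => Iff.rfl⟩
  | rel R t =>
    exact ⟨{p | p.holds ⟨R, hS rfl⟩ t}, Eventually.of_forall fun X a => Iff.rfl⟩
  | not φ ih =>
    obtain ⟨T, hT⟩ := ih hS hl hr
    exact ⟨Tᶜ, hT.mono fun X hX a => not_congr (hX a)⟩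
  | and φ ψ ih1 ih2 =>
    simp only [CPL.symbols, CPL.qr, CPL.thresholds, Set.union_subset_iff] at hS hl hr
    obtain ⟨T1, h1⟩ := ih1 hS.1 (by omega) fun r h => hr r (Or.inl h)
    obtain ⟨T2, h2⟩ := ih2 hS.2 (by omega) fun r h => hr r (Or.inr h)
    refine ⟨{p | p ∈ T1 ∧ p ∈ T2}, ?_⟩
    filter_upwards [h1, h2] with X h1 h2 a
    exact and_congr (h1 a) (h2 a)
  | or φ ψ ih1 ih2 =>
    simp only [CPL.symbols, CPL.qr, CPL.thresholds, Set.union_subset_iff] at hS hl hr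
    obtain ⟨T1, h1⟩ := ih1 hS.1 (by omega) fun r h => hr r (Or.inl h)
    obtain ⟨T2, h2⟩ := ih2 hS.2 (by omega) fun r h => hr r (Or.inr h)
    refine ⟨{p | p ∈ T1 ∨ p ∈ T2}, ?_⟩
    filter_upwards [h1, h2] with X h1 h2 a
    exact or_congr (h1 a) (h2 a)
  | imp φ ψ ih1 ih2 =>
    simp only [CPL.symbols, CPL.qr, CPL.thresholds, Set.union_subset_iff] at hS hl hr
    obtain ⟨T1, h1⟩ := ih1 hS.1 (by omega) fun r h => hr r (Or.inl h)
    obtain ⟨T2, h2⟩ := ih2 hS.2 (by omega) fun r h => hr r (Or.inr h)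
    refine ⟨{p | p ∈ T1 → p ∈ T2}, ?_⟩
    filter_upwards [h1, h2] with X h1 h2 a
    exact imp_congr (h1 a) (h2 a)
  | iff φ ψ ih1 ih2 =>
    simp only [CPL.symbols, CPL.qr, CPL.thresholds, Set.union_subset_iff] at hS hl hr
    obtain ⟨T1, h1⟩ := ih1 hS.1 (by omega) fun r h => hr r (Or.inl h)
    obtain ⟨T2, h2⟩ := ih2 hS.2 (by omega) fun r h => hr r (Or.inr h)
    refine ⟨{p | p ∈ T1 ↔ p ∈ T2}, ?_⟩
    filter_upwards [h1, h2] with X h1 h2 a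
    exact iff_congr (h1 a) (h2 a)
  | @ex k φ ih =>
    simp only [CPL.symbols, CPL.qr, CPL.thresholds] at hS hl hr
    obtain ⟨T, hT⟩ := ih hS (by omega) hr
    refine hF.exists_set_types (P := fun X a => (CPL.ex φ).Sat X.2 a) fun q hq => ?_
    have hiff : ∀ Y : (Σ X : (Σ n : ℕ, RelStr ar (Fin n)), (Fin k → Fin X.1)),
        (CPL.ex φ).Sat Y.1.2 Y.2 ↔ {b : Fin 1 → Fin Y.1.1 | φ.Sat Y.1.2 (Fin.append Y.2 b)}.Nonempty := by
      intro Y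
      constructor
      · rintro ⟨b, hb⟩
        refine ⟨fun _ => b, ?_⟩
        rw [← Fin.append_right_eq_snoc Y.2 (fun _ => b)] at hb
        exact hb
      · rintro ⟨b, hb⟩
        refine ⟨b 0, ?_⟩
        rw [← Fin.append_right_eq_snoc Y.2 b]
        exact hb
    simp only [hiff]
    -- For an existential quantifier only the emptiness dichotomy is needed, not the convergence of
    -- proportions.
    rcases hF.eventually_empty_or_tendsto_proportion hC0 hC (e := 1) (by omega) hq
      (Ψ := fun X c => φ.Sat X.2 c) hT with h | h
    · exact ⟨False, h.mono fun Y hY => iff_false_intro hY⟩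
    · exact ⟨True, h.1.mono fun Y hY => iff_true_intro hY⟩
  | @probLeft k e r φ ψ θ τ ih1 ih2 ih3 ih4 =>
    simp only [CPL.symbols, CPL.qr, CPL.thresholds, Set.union_subset_iff] at hS hl hr
    obtain ⟨T1, h1⟩ := ih1 hS.1.1.1 (by omega) fun r h => hr r (by simp [h])
    obtain ⟨T2, h2⟩ := ih2 hS.1.1.2 (by omega) fun r h => hr r (by simp [h])
    obtain ⟨T3, h3⟩ := ih3 hS.1.2 (by omega) fun r h => hr r (by simp [h])
    obtain ⟨T4, h4⟩ := ih4 hS.2 (by omega) fun r h => hr r (by simp [h])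
    refine hF.exists_set_types (P := fun X a => (CPL.probLeft e r φ ψ θ τ).Sat X.2 a) fun q hq => ?_
    rcases hF.eventually_empty_or_tendsto_proportion hC0 hC (by omega) hq
      (Ψ := fun X c => ψ.Sat X.2 c) h2 with hψ | ⟨hψ, hφψ⟩
    · exact ⟨False, hψ.mono fun Y hY => iff_false_intro fun h => hY h.1⟩
    rcases hF.eventually_empty_or_tendsto_proportion hC0 hC (by omega) hq
      (Ψ := fun X c => τ.Sat X.2 c) h4 with hτ | ⟨hτ, hθτ⟩
    · exact ⟨False, hτ.mono fun Y hY => iff_false_intro fun h => hY h.2.1⟩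
    obtain ⟨α, hα, hlimα⟩ := hφψ (fun X c => φ.Sat X.2 c) T1 h1
    obtain ⟨β, hβ, hlimβ⟩ := hθτ (fun X c => θ.Sat X.2 c) T3 h3
    -- The limit `r + α - β` is nonzero because `r` is not the difference `β - α` of critical
    -- numbers.
    obtain ⟨b, hb⟩ := exists_eventually_nonneg_iff ((hlimα.const_add (r : ℝ)).sub hlimβ)
      (fun h => hr r (by simp) β α hβ hα (by linarith))
    refine ⟨b, ?_⟩
    filter_upwards [hb, hψ, hτ] with Y hb hψ hτ
    rw [← hb, sub_nonneg]
    exact ⟨fun h => h.2.2, fun h => ⟨hψ, hτ, h⟩⟩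
  | @probRight k e r φ ψ θ τ ih1 ih2 ih3 ih4 =>
    simp only [CPL.symbols, CPL.qr, CPL.thresholds, Set.union_subset_iff] at hS hl hr
    obtain ⟨T1, h1⟩ := ih1 hS.1.1.1 (by omega) fun r h => hr r (by simp [h])
    obtain ⟨T2, h2⟩ := ih2 hS.1.1.2 (by omega) fun r h => hr r (by simp [h])
    obtain ⟨T3, h3⟩ := ih3 hS.1.2 (by omega) fun r h => hr r (by simp [h])
    obtain ⟨T4, h4⟩ := ih4 hS.2 (by omega) fun r h => hr r (by simp [h])
    refine hF.exists_set_types (P := fun X a => (CPL.probRight e r φ ψ θ τ).Sat X.2 a) fun q hq => ?_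
    rcases hF.eventually_empty_or_tendsto_proportion hC0 hC (by omega) hq
      (Ψ := fun X c => ψ.Sat X.2 c) h2 with hψ | ⟨hψ, hφψ⟩
    · exact ⟨False, hψ.mono fun Y hY => iff_false_intro fun h => hY h.1⟩
    rcases hF.eventually_empty_or_tendsto_proportion hC0 hC (by omega) hq
      (Ψ := fun X c => τ.Sat X.2 c) h4 with hτ | ⟨hτ, hθτ⟩
    · exact ⟨False, hτ.mono fun Y hY => iff_false_intro fun h => hY h.2.1⟩
    obtain ⟨α, hα, hlimα⟩ := hφψ (fun X c => φ.Sat X.2 c) T1 h1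
    obtain ⟨β, hβ, hlimβ⟩ := hθτ (fun X c => θ.Sat X.2 c) T3 h3
    -- Here the limit is `α - (β + r)`, nonzero because `r ≠ α - β`.
    obtain ⟨b, hb⟩ := exists_eventually_nonneg_iff (hlimα.sub (hlimβ.add_const (r : ℝ)))
      (fun h => hr r (by simp) α β hα hβ (by linarith))
    refine ⟨b, ?_⟩
    filter_upwards [hb, hψ, hτ] with Y hb hψ hτ
    rw [← hb, sub_nonneg]
    exact ⟨fun h => h.2.2, fun h => ⟨hψ, hτ, h⟩⟩

end QuantifierElimination

/-! ### Lifted Bayesian networks as networks on the ground atoms -/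

lemma CPL.sat_congr {σ : Type u} {ar : σ → ℕ} {α : Type v} {A B : RelStr ar α} {k : ℕ}
    (φ : CPL ar k) (h : ∀ R ∈ φ.symbols, A R = B R) (a : Fin k → α) : φ.Sat A a ↔ φ.Sat B a := by
  induction φ with
  | top => exact Iff.rfl
  | eq i j => exact Iff.rfl
  | rel R t => simp only [CPL.Sat, h R rfl]
  | not φ ih => exact not_congr (ih h a)
  | and φ ψ ih1 ih2 =>
    exact and_congr (ih1 (fun R hR => h R (Or.inl hR)) a) (ih2 (fun R hR => h R (Or.inr hR)) a)
  | or φ ψ ih1 ih2 =>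
    exact or_congr (ih1 (fun R hR => h R (Or.inl hR)) a) (ih2 (fun R hR => h R (Or.inr hR)) a)
  | imp φ ψ ih1 ih2 =>
    exact imp_congr (ih1 (fun R hR => h R (Or.inl hR)) a) (ih2 (fun R hR => h R (Or.inr hR)) a)
  | iff φ ψ ih1 ih2 =>
    exact iff_congr (ih1 (fun R hR => h R (Or.inl hR)) a) (ih2 (fun R hR => h R (Or.inr hR)) a)
  | ex φ ih => exact exists_congr fun b => ih h _
  | probLeft e r φ ψ θ τ ih1 ih2 ih3 ih4 =>
    simp only [CPL.symbols] at h
    simp only [CPL.Sat, ih1 fun R hR => h R (by simp [hR]), ih2 fun R hR => h R (by simp [hR]),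
      ih3 fun R hR => h R (by simp [hR]), ih4 fun R hR => h R (by simp [hR])]
  | probRight e r φ ψ θ τ ih1 ih2 ih3 ih4 =>
    simp only [CPL.symbols] at h
    simp only [CPL.Sat, ih1 fun R hR => h R (by simp [hR]), ih2 fun R hR => h R (by simp [hR]),
      ih3 fun R hR => h R (by simp [hR]), ih4 fun R hR => h R (by simp [hR])]

section Select

open Classical

/-- The value `x i` at some `i` with `P i`. -/
noncomputable def select {m : ℕ} (x : Fin m → ℝ) (P : Fin m → Prop) : ℝ :=
  -- The default only has to lie in `[0, 1]`, so that `select` is always a probability.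
  if h : ∃ i, P i then x h.choose else 1 / 2

lemma select_eq {m : ℕ} (x : Fin m → ℝ) {P : Fin m → Prop} {i : Fin m} (hi : P i)
    (h : ∀ j, P j → j = i) : select x P = x i := by
  have hex : ∃ i, P i := ⟨i, hi⟩
  rw [select, dif_pos hex, h _ hex.choose_spec]

lemma select_mem {m : ℕ} {x : Fin m → ℝ} (hx : ∀ i, 0 ≤ x i ∧ x i ≤ 1) (P : Fin m → Prop) :
    0 ≤ select x P ∧ select x P ≤ 1 := by
  unfold select
  split_ifs
  · exact hx _
  · norm_num

end Select

/-- Structures are determined by the ground atoms that hold. -/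
def strEquiv {σ : Type u} (ar : σ → ℕ) (n : ℕ) : (GroundAtom ar n → Prop) ≃ RelStr ar (Fin n) where
  toFun := strOf
  invFun := fun A i => A i.1 i.2
  left_inv := fun _ => rfl
  right_inv := fun _ => rfl

namespace LiftedBayesNet

open AtomicType LocalNet Classical

variable {σ : Type u} {ar : σ → ℕ} (G : LiftedBayesNet ar)

/-- The probability of `R(t)` in a structure generated by the network, given the parents of `R`. -/
noncomputable def nodeProb (n : ℕ) (i : GroundAtom ar n) (ω : GroundAtom ar n → Prop) : ℝ :=
  select (G.μ i.1) fun j => (G.agg i.1 j).Sat (strOf ω) i.2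

lemma nodeProb_nonneg (n : ℕ) (i : GroundAtom ar n) (ω : GroundAtom ar n → Prop) :
    0 ≤ G.nodeProb n i ω := (select_mem (G.μ_mem i.1) _).1

lemma nodeProb_le_one (n : ℕ) (i : GroundAtom ar n) (ω : GroundAtom ar n → Prop) :
    G.nodeProb n i ω ≤ 1 := (select_mem (G.μ_mem i.1) _).2

/-- The ground atoms whose relation symbol is an ancestor of that of `i`. -/
def groundDep (n : ℕ) (i : GroundAtom ar n) : Set (GroundAtom ar n) := {j | j.1 ∈ G.ancestors i.1}

lemma ancestors_subset {R Q : σ} (h : Q ∈ G.ancestors R) : G.ancestors Q ⊆ G.ancestors R :=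
  fun _ hP => Relation.TransGen.trans hP h

/-- By acyclicity `Q` is not its own ancestor, so the inclusion is strict. The number of ancestors
is thus a rank function, and also the parameter of the induction over the network. -/
lemma ncard_ancestors_lt [Finite σ] {R Q : σ} (h : Q ∈ G.ancestors R) :
    (G.ancestors Q).ncard < (G.ancestors R).ncard :=
  Set.ncard_lt_ncard ((Set.ssubset_iff_of_subset (G.ancestors_subset h)).2 ⟨Q, h, G.acyclic Q⟩)

lemma nodeProb_congr {n : ℕ} {i : GroundAtom ar n} {ω ω' : GroundAtom ar n → Prop}
    (h : ∀ R ∈ G.ancestors i.1, strOf ω R = strOf ω' R) : G.nodeProb n i ω = G.nodeProb n i ω' := by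
  have : (fun j => (G.agg i.1 j).Sat (strOf ω) i.2) = fun j => (G.agg i.1 j).Sat (strOf ω') i.2 := by
    funext j
    exact propext (CPL.sat_congr _ (fun R hR => h R (.single (G.agg_parents _ _ hR))) _)
  rw [nodeProb, nodeProb, this]

lemma isNet [Finite σ] (n : ℕ) :
    IsNet (G.nodeProb n) (G.groundDep n) (fun i => (G.ancestors i.1).ncard) where
  dependsOn := fun _ _ _ h => G.nodeProb_congr fun R hR => funext fun t => h ⟨R, t⟩ hR
  rank_lt := fun _ _ hj => G.ncard_ancestors_lt hj

variable [Fintype σ]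

/-- Each tuple satisfies exactly one aggregation formula, so the product over `i` collapses to one
factor per ground atom. The partition property is only available on nonempty domains. -/
lemma weight_eq {n : ℕ} (hn : 0 < n) (ω : GroundAtom ar n → Prop) :
    G.weight n (strOf ω) = netWeight (G.nodeProb n) Finset.univ ω := by
  rw [weight, netWeight, Fintype.prod_sigma]
  refine Finset.prod_congr rfl fun R _ => ?_
  simp only [Finset.prod_filter]
  rw [Finset.prod_comm]
  refine Finset.prod_congr rfl fun t _ => ?_
  obtain ⟨i, hi⟩ := G.agg_cover R n hn (strOf ω) t
  have huniq : ∀ j, (G.agg R j).Sat (strOf ω) t → j = i := fun j hj => by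
    by_contra hne
    exact G.agg_disjoint R j i hne n hn (strOf ω) t ⟨hj, hi⟩
  rw [Finset.prod_eq_single i (fun j _ hj => if_neg fun h => hj (huniq j h)) (by simp), if_pos hi,
    nodeProb, select_eq (G.μ R) hi huniq]
  rfl

lemma prob_eq {n : ℕ} (hn : 0 < n) (X : Set (RelStr ar (Fin n))) :
    G.prob n X = netProb (G.nodeProb n) (strOf ⁻¹' X) := by
  rw [prob, netProb, netExp, Finset.sum_filter, ← Equiv.sum_comp (strEquiv ar n)]
  refine Finset.sum_congr (by ext; simp) fun ω _ => ?_
  have : strEquiv ar n ω = strOf ω := rfl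
  rw [this, G.weight_eq hn, Set.indicator_apply]
  by_cases h : strOf ω ∈ X <;> simp [h]

variable {G} {L : LocalNet ar G.ancestors} {S : Set σ}

/-- If almost surely the conditional probabilities agree for the symbols in `S`, then the
distributions on reducts to `S` are exponentially close. -/
theorem exists_abs_prob_sub_le (hS : ∀ R ∈ S, G.ancestors R ⊆ S)
    (hL : ∀ R ∈ S, ∀ᶠ X in L.expAlmostSure, ∀ t : Fin (ar R) → Fin X.1,
      select (G.μ R) (fun j => (G.agg R j).Sat X.2 t) = L.prob R (typeOf (G.ancestors R) X.2 t)) :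
    ∃ c > 0, ∀ᶠ n : ℕ in atTop, ∀ X : Set (RelStr ar (Fin n)),
      (∀ A B : RelStr ar (Fin n), (∀ R ∈ S, A R = B R) → (A ∈ X ↔ B ∈ X)) →
      |G.prob n X - L.strProb n X| ≤ Real.exp (-(c * n)) := by
  have hall : ∀ᶠ X in L.expAlmostSure, ∀ R, R ∈ S → ∀ t : Fin (ar R) → Fin X.1,
      select (G.μ R) (fun j => (G.agg R j).Sat X.2 t) = L.prob R (typeOf (G.ancestors R) X.2 t) := by
    rw [eventually_all]
    intro R
    by_cases hR : R ∈ S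
    · exact (hL R hR).mono fun X hX _ => hX
    · exact Eventually.of_forall fun X h => absurd h hR
  obtain ⟨c, hc, hev⟩ := eventually_expAlmostSure.1 hall
  refine ⟨c, hc, ?_⟩
  filter_upwards [hev, eventually_gt_atTop 0] with n hn hn0 X hX
  refine le_trans ?_ hn
  -- Nothing is known about `L` outside `S`. The hybrid has the same distribution as `G` on reducts
  -- to the closed set `S`, and outside the bad event it agrees with `L` at every node.
  let hyb : GroundAtom ar n → (GroundAtom ar n → Prop) → ℝ := fun i =>
    if i.1 ∈ S then G.nodeProb n i else L.nodeProb n i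
  have hdepS : ∀ i ∈ block (ar := ar) S (Set.univ : Set (Fin n)),
      G.groundDep n i ⊆ block (ar := ar) S (Set.univ : Set (Fin n)) := by
    intro i hi j hj
    exact Finset.mem_coe.2 (mem_block.2 ⟨hS _ (mem_block.1 hi).1 hj, fun _ => trivial⟩)
  have hnet : IsNet hyb (G.groundDep n) (fun i => (G.ancestors i.1).ncard) := by
    refine ⟨fun i => ?_, (G.isNet n).rank_lt⟩
    by_cases hi : i.1 ∈ S
    · simpa only [hyb, if_pos hi] using (G.isNet n).dependsOn i
    · simp only [hyb, if_neg hi]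
      exact fun x y h => (L.isNet n).dependsOn i fun j hj => h j hj.1
  have hindep : DependsOn ((strOf ⁻¹' X).indicator (1 : (GroundAtom ar n → Prop) → ℝ))
      (block (ar := ar) S (Set.univ : Set (Fin n))) := by
    intro ω ω' h
    have h1 : ω ∈ strOf ⁻¹' X ↔ ω' ∈ strOf ⁻¹' X := hX _ _ fun R hR => funext fun t =>
      h ⟨R, t⟩ (Finset.mem_coe.2 (mem_block.2 ⟨hR, fun _ => trivial⟩))
    by_cases h2 : ω' ∈ strOf ⁻¹' X
    · rw [Set.indicator_of_mem h2, Set.indicator_of_mem (h1.2 h2)]; rfl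
    · rw [Set.indicator_of_notMem h2, Set.indicator_of_notMem (fun h => h2 (h1.1 h))]
  have e1 : G.prob n X = netProb hyb (strOf ⁻¹' X) := by
    rw [G.prob_eq hn0]
    exact (G.isNet n).netExp_congr hnet hdepS hdepS
      (fun i hi => by simp only [hyb, if_pos (mem_block.1 hi).1]) hindep
  rw [e1]
  refine hnet.abs_netProb_sub_le (L.isNet n) ?_ ?_ (L.nodeProb_nonneg n) (L.nodeProb_le_one n) ?_ _
  · intro i ω
    by_cases hi : i.1 ∈ S
    · simp only [hyb, if_pos hi]; exact G.nodeProb_nonneg n i ω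
    · simp only [hyb, if_neg hi]; exact L.nodeProb_nonneg n i ω
  · intro i ω
    by_cases hi : i.1 ∈ S
    · simp only [hyb, if_pos hi]; exact G.nodeProb_le_one n i ω
    · simp only [hyb, if_neg hi]; exact L.nodeProb_le_one n i ω
  · intro ω hω i
    by_cases hi : i.1 ∈ S
    · simp only [hyb, if_pos hi]
      by_contra hne
      exact hω fun h => hne (h i.1 hi i.2)
    · simp only [hyb, if_neg hi]

/-- In the local network the probability of `p(a)` does not vary with `n` and `a`, so closeness of
the distributions makes the limit uniform in `a`. -/
theorem isTypeLimit (hS : ∀ R ∈ S, G.ancestors R ⊆ S)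
    (hL : ∀ R ∈ S, ∀ᶠ X in L.expAlmostSure, ∀ t : Fin (ar R) → Fin X.1,
      select (G.μ R) (fun j => (G.agg R j).Sat X.2 t) = L.prob R (typeOf (G.ancestors R) X.2 t))
    {k : ℕ} (p : AtomicType ar S k) : G.IsTypeLimit p (L.typeProb p) := by
  intro ε hε
  obtain ⟨c, hc, hev⟩ := exists_abs_prob_sub_le hS hL
  have hlim : Tendsto (fun n : ℕ => Real.exp (-(c * n))) atTop (𝓝 0) :=
    Real.tendsto_exp_neg_atTop_nhds_zero.comp (tendsto_natCast_atTop_atTop.const_mul_atTop hc)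
  obtain ⟨N, hN⟩ := eventually_atTop.1 (hev.and (hlim.eventually_le_const hε))
  refine ⟨N, fun n hn a ha => ?_⟩
  rw [← strProb_realizes hS p ha]
  refine ((hN n hn).1 _ fun A B h => ?_).trans (hN n hn).2
  have : ∀ R : S, A R = B R := fun R => h R R.2
  simp only [Set.mem_ofPred_eq, Realizes, this]

/-- A noncritical formula is almost surely equivalent to a quantifier-free formula. -/
theorem exists_types (hS : ∀ R ∈ S, G.ancestors R ⊆ S)
    (hL : ∀ R ∈ S, ∀ᶠ X in L.expAlmostSure, ∀ t : Fin (ar R) → Fin X.1,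
      select (G.μ R) (fun j => (G.agg R j).Sat X.2 t) = L.prob R (typeOf (G.ancestors R) X.2 t))
    {k : ℕ} (φ : CPL ar k) (hφ : φ.symbols ⊆ S) (hcrit : G.Noncritical S φ) :
    ∃ T : Set (AtomicType ar S k), ∀ᶠ X in L.expAlmostSure, ∀ a,
      φ.Sat X.2 a ↔ typeOf S X.2 a ∈ T := by
  refine (genericLimit hS).exists_types (C := G.IsCritical S (k + φ.qr)) (l := k + φ.qr) ?_ ?_ φ hφ
    le_rfl hcrit
  -- The limit 0 is critical as the fraction `0 / 1`; all other limits of proportions come from the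
  -- first clause.
  · exact Or.inr ⟨0, 1, zero_le_one, le_rfl, le_max_left _ _, by simp⟩
  · intro k e q T U hl hq hT hTU hU hpos
    exact Or.inl ⟨k, k + e, Nat.le_add_right k e, hl, q, L.typeProb q, T, U, fun p => L.typeProb p,
      isTypeLimit hS hL q, hq, hT, hTU, fun p hp => ⟨hU p hp, isTypeLimit hS hL p⟩, hpos, rfl⟩

/-- Almost sure properties of reducts to `S` depend only on the subnetwork induced by `S`. -/
lemma eventually_of_agree {L L' : LocalNet ar G.ancestors} (hS : ∀ R ∈ S, G.ancestors R ⊆ S)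
    (hLL' : ∀ R ∈ S, L.prob R = L'.prob R) {P : (Σ n : ℕ, RelStr ar (Fin n)) → Prop}
    (hP : ∀ n (A B : RelStr ar (Fin n)), (∀ R ∈ S, A R = B R) → (P ⟨n, A⟩ ↔ P ⟨n, B⟩))
    (h : ∀ᶠ X in L.expAlmostSure, P X) : ∀ᶠ X in L'.expAlmostSure, P X := by
  rw [eventually_expAlmostSure] at h ⊢
  obtain ⟨c, hc, h⟩ := h
  refine ⟨c, hc, h.mono fun n hn => le_of_eq_of_le ?_ hn⟩
  have hb := localDep_subset_block (ar := ar) hS (Set.univ : Set (Fin n))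
  refine ((L.isNet n).netExp_congr (L'.isNet n) hb hb (fun i hi => ?_) ?_).symm
  · funext ω
    simp only [LocalNet.nodeProb, hLL' i.1 (mem_block.1 hi).1]
  · intro ω ω' h
    have h1 : ω ∈ strOf ⁻¹' {A | ¬ P ⟨n, A⟩} ↔ ω' ∈ strOf ⁻¹' {A | ¬ P ⟨n, A⟩} :=
      not_congr (hP _ _ _ fun R hR => funext fun t =>
        h ⟨R, t⟩ (Finset.mem_coe.2 (mem_block.2 ⟨hR, fun _ => trivial⟩)))
    by_cases h2 : ω' ∈ strOf ⁻¹' {A | ¬ P ⟨n, A⟩}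
    · rw [Set.indicator_of_mem h2, Set.indicator_of_mem (h1.2 h2)]; rfl
    · rw [Set.indicator_of_notMem h2, Set.indicator_of_notMem (fun h => h2 (h1.1 h))]

/-- Induction over the number of ancestors. Once the ancestors of `R` are governed by a local
network, the aggregation formulas of `R` are almost surely equivalent to sets of types over these
ancestors, which define the local probabilities of `R`. -/
theorem exists_localNet (hG : ∀ (R : σ) (i : Fin (G.num R)), G.Noncritical (G.ancestors R) (G.agg R i))
    (m : ℕ) : ∃ L : LocalNet ar G.ancestors, ∀ R, (G.ancestors R).ncard < m →
      ∀ᶠ X in L.expAlmostSure, ∀ t : Fin (ar R) → Fin X.1,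
        select (G.μ R) (fun j => (G.agg R j).Sat X.2 t)
          = L.prob R (typeOf (G.ancestors R) X.2 t) := by
  induction m with
  | zero =>
    exact ⟨⟨fun R => (G.ancestors R).ncard, fun R Q h => G.ncard_ancestors_lt h, fun _ _ => 1,
      fun _ _ => zero_le_one, fun _ _ => le_rfl⟩, fun R h => absurd h (Nat.not_lt_zero _)⟩
  | succ m ih =>
    obtain ⟨L, hL⟩ := ih
    have hex : ∀ R, ∃ g : AtomicType ar (G.ancestors R) (ar R) → ℝ, (∀ p, 0 ≤ g p ∧ g p ≤ 1) ∧
        ((G.ancestors R).ncard = m → ∀ᶠ X in L.expAlmostSure, ∀ t : Fin (ar R) → Fin X.1,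
          select (G.μ R) (fun j => (G.agg R j).Sat X.2 t) = g (typeOf (G.ancestors R) X.2 t)) := by
      intro R
      by_cases hR : (G.ancestors R).ncard = m
      swap
      · exact ⟨fun _ => 1, fun _ => ⟨zero_le_one, le_rfl⟩, fun h => absurd h hR⟩
      have hT := fun i => exists_types (S := G.ancestors R) (fun Q hQ => G.ancestors_subset hQ)
        (fun Q hQ => hL Q (hR ▸ G.ncard_ancestors_lt hQ)) (G.agg R i)
        (fun Q hQ => .single (G.agg_parents _ _ hQ)) (hG R i)
      choose T hT using hT
      refine ⟨fun p => select (G.μ R) fun j => p ∈ T j, fun p => select_mem (G.μ_mem R) _,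
        fun _ => (eventually_all.2 hT).mono fun X hX t => ?_⟩
      -- The sets `T j` need not partition the types, as they are arbitrary on types of probability
      -- zero. This is harmless: equal predicates give equal values of `select`, whatever choice it
      -- makes.
      congr 1
      funext j
      exact propext (hX j t)
    choose g hg01 hg using hex
    -- Only symbols with exactly `m` ancestors are changed. The ancestors of any symbol with at most
    -- `m` ancestors keep their probabilities, so almost sure statements about them carry over from
    -- `L` to `L'`.
    let L' : LocalNet ar G.ancestors :=
      ⟨fun R => (G.ancestors R).ncard, fun R Q h => G.ncard_ancestors_lt h,
        fun R => if (G.ancestors R).ncard = m then g R else L.prob R,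
        fun R p => by
          split_ifs
          · exact (hg01 R p).1
          · exact L.prob_nonneg R p,
        fun R p => by
          split_ifs
          · exact (hg01 R p).2
          · exact L.prob_le_one R p⟩
    refine ⟨L', fun R hR => ?_⟩
    refine eventually_of_agree (L := L) (S := G.ancestors R) (fun Q hQ => G.ancestors_subset hQ)
      (fun Q hQ => (if_neg ?_).symm) ?_ ?_
    · have := G.ncard_ancestors_lt hQ
      omega
    · intro n A B hAB
      refine forall_congr' fun t => ?_
      have h1 : ∀ j, (G.agg R j).Sat A t ↔ (G.agg R j).Sat B t := fun j =>
        CPL.sat_congr _ (fun Q hQ => hAB Q (.single (G.agg_parents _ _ hQ))) t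
      have h2 : typeOf (G.ancestors R) A t = typeOf (G.ancestors R) B t := by
        ext1
        · rfl
        · funext Q s
          exact congrFun (hAB Q Q.2) _
      simp only [h1, h2]
    · by_cases h : (G.ancestors R).ncard = m
      · simpa only [L', if_pos h] using hg R h
      · simpa only [L', if_neg h] using hL R (by omega)

end LiftedBayesNet

/-! ### Convergence -/

namespace AtomicType

/-- Without nullary symbols there are no atoms in zero variables. -/
lemma subsingleton_zero {σ : Type u} {ar : σ → ℕ} (har : ∀ R, 0 < ar R) (S : Set σ) :
    Subsingleton (AtomicType ar S 0) := by
  refine ⟨fun p q => ?_⟩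
  ext1
  · ext i
    exact i.elim0
  · funext R t
    exact (t ⟨0, har R⟩).elim0

end AtomicType

lemma Setoid.exists_ker_eq {k : ℕ} (E : Setoid (Fin k)) : ∃ a : Fin k → Fin k, Setoid.ker a = E := by
  refine ⟨fun i => (Quotient.mk E i).out, ?_⟩
  ext i j
  rw [Setoid.ker_def, Quotient.out_inj]
  exact Quotient.eq

namespace LocalNet

open AtomicType Classical

variable {σ : Type u} [Fintype σ] {ar : σ → ℕ} {par : σ → Set σ} {L : LocalNet ar par} {S : Set σ}

lemma strProb_typeOf_mem {k n : ℕ} (W : Finset (AtomicType ar S k)) (a : Fin k → Fin n) :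
    L.strProb n {A | typeOf S A a ∈ W} = ∑ p ∈ W, L.strProb n {A | p.Realizes A a} := by
  simp only [strProb, netProb]
  rw [← netExp_sum]
  congr 1
  funext ω
  simp [Set.indicator_apply, realizes_iff_typeOf_eq]

lemma sum_typeProb (hS : ∀ R ∈ S, par R ⊆ S) {k n : ℕ} {W : Finset (AtomicType ar S k)}
    {a : Fin k → Fin n} (hW : ∀ p ∈ W, p.ident = Setoid.ker a) :
    ∑ p ∈ W, L.typeProb p = L.strProb n {A | typeOf S A a ∈ W} := by
  rw [strProb_typeOf_mem]
  exact Finset.sum_congr rfl fun p hp => (strProb_realizes hS p (hW p hp).symm).symm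

end LocalNet

namespace LiftedBayesNet

open AtomicType LocalNet Classical

variable {σ : Type u} [Fintype σ] {ar : σ → ℕ} {G : LiftedBayesNet ar}

/-- The limit is the local probability that the type of a tuple with pattern `E` lies in the set `T`
to which `φ` reduces. Two exponentially small errors add up: passing from `G` to the local network,
and from `φ` to `T`. -/
theorem exists_limit (har : ∀ R, 0 < ar R)
    (hG : ∀ (R : σ) (i : Fin (G.num R)), G.Noncritical (G.ancestors R) (G.agg R i))
    {k : ℕ} (φ : CPL ar k) (hφ : G.Noncritical Set.univ φ) :
    ∃ c > 0, ∃ d : Setoid (Fin k) → ℝ,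
      (∀ E, 0 ≤ d E ∧ d E ≤ 1 ∧ (∃ l : ℕ, 0 < l ∧ G.IsCritical Set.univ l (d E)) ∧
        (k = 0 → d E = 0 ∨ d E = 1)) ∧
      ∀ᶠ n : ℕ in atTop, ∀ a : Fin k → Fin n,
        |G.prob n {A | φ.Sat A a} - d (Setoid.ker a)| ≤ Real.exp (-(c * n)) := by
  have := Fintype.ofFinite (AtomicType ar (Set.univ : Set σ) k)
  have hS : ∀ R ∈ (Set.univ : Set σ), G.ancestors R ⊆ Set.univ := fun _ _ => Set.subset_univ _
  obtain ⟨L, hL⟩ := exists_localNet hG (Fintype.card σ + 1)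
  have hL' : ∀ R ∈ (Set.univ : Set σ), ∀ᶠ X in L.expAlmostSure, ∀ t : Fin (ar R) → Fin X.1,
      select (G.μ R) (fun j => (G.agg R j).Sat X.2 t) = L.prob R (typeOf (G.ancestors R) X.2 t) := by
    intro R _
    refine hL R (Nat.lt_succ_of_le ?_)
    rw [← Nat.card_eq_fintype_card]
    exact Set.ncard_le_card _
  obtain ⟨T, hT⟩ := exists_types hS hL' φ (Set.subset_univ _) hφ
  obtain ⟨c1, hc1, h1⟩ := exists_abs_prob_sub_le hS hL'
  obtain ⟨c2, hc2, h2⟩ := eventually_expAlmostSure.1 hT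
  have hc : 0 < min c1 c2 := lt_min hc1 hc2
  let W : Setoid (Fin k) → Finset (AtomicType ar (Set.univ : Set σ) k) := fun E =>
    Finset.univ.filter fun p => p ∈ T ∧ p.ident = E
  let U : Setoid (Fin k) → Finset (AtomicType ar (Set.univ : Set σ) k) := fun E =>
    Finset.univ.filter fun p => p.ident = E
  have hWU : ∀ E, W E ⊆ U E := fun E p hp =>
    Finset.mem_filter.2 ⟨Finset.mem_univ _, (Finset.mem_filter.1 hp).2.2⟩
  have hd : ∀ {n : ℕ} (a : Fin k → Fin n), ∑ p ∈ W (Setoid.ker a), L.typeProb p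
      = L.strProb n {A | typeOf Set.univ A a ∈ T} := by
    intro n a
    rw [sum_typeProb hS fun p hp => (Finset.mem_filter.1 hp).2.2]
    congr 1
    ext A
    simp only [W, Set.mem_ofPred_eq, Finset.mem_filter, Finset.mem_univ, true_and]
    exact and_iff_left rfl
  have hUsum : ∀ E, ∑ p ∈ U E, L.typeProb p = 1 := by
    intro E
    obtain ⟨a, rfl⟩ := Setoid.exists_ker_eq E
    rw [sum_typeProb hS fun p hp => (Finset.mem_filter.1 hp).2]
    rw [← L.strProb_univ k]
    congr 1
    ext A
    simp only [Set.mem_ofPred_eq, Finset.mem_filter, Finset.mem_univ, true_and, Set.mem_univ,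
      iff_true]
    rfl
  refine ⟨min c1 c2 / 2, half_pos hc, fun E => ∑ p ∈ W E, L.typeProb p, fun E => ⟨?_, ?_, ?_, ?_⟩, ?_⟩
  · exact Finset.sum_nonneg fun p _ => typeProb_nonneg p
  · rw [← hUsum E]
    exact Finset.sum_le_sum_of_subset_of_nonneg (hWU E) fun p _ _ => typeProb_nonneg p
  · refine ⟨max 1 k, by simp, ?_⟩
    rcases (W E).eq_empty_or_nonempty with h0 | h0
    · exact Or.inr ⟨0, 1, zero_le_one, le_rfl, le_max_left _ _, by simp [h0]⟩
    · have hsub := subsingleton_zero har (Set.univ : Set σ)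
      obtain ⟨p0, _⟩ := h0
      -- The empty type has probability 1, and so do all types with pattern `E` together; hence `d
      -- E` is the critical quotient for `q` and the sets `W E ⊆ U E`.
      let q := p0.restrict (Nat.zero_le k)
      have hq : L.typeProb q = 1 := by
        rw [← L.strProb_univ 0, typeProb]
        congr 1
        ext A
        simp only [Set.mem_ofPred_eq, realizes_iff_typeOf_eq, Set.mem_univ, iff_true]
        exact Subsingleton.elim _ _
      refine Or.inl ⟨0, k, Nat.zero_le k, le_max_right _ _, q, 1, W E, U E, fun p => L.typeProb p,
        hq ▸ isTypeLimit hS hL' q, one_pos, ⟨p0, ‹_›⟩, hWU E,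
        fun p _ => ⟨Subsingleton.elim _ _, isTypeLimit hS hL' p⟩, ?_, ?_⟩
      · simp [hUsum E]
      · simp [hUsum E]
  · rintro rfl
    have hsub := subsingleton_zero har (Set.univ : Set σ)
    rcases (W E).eq_empty_or_nonempty with h0 | ⟨p0, h0⟩
    · left
      simp [h0]
    · right
      -- With only one type in zero variables, a nonempty `W E` is everything and the limit is 1.
      have hWUE : W E = U E := (hWU E).antisymm fun p _ => Subsingleton.elim p0 p ▸ h0
      simp only [hWUE, hUsum E]
  · filter_upwards [h1, h2, eventually_const_mul_pow_mul_exp_le 2 0 hc] with n h1 h2 h3 a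
    have e1 := h1 {A | φ.Sat A a} fun A B h => φ.sat_congr (fun R _ => h R trivial) a
    have e2 : |L.strProb n {A | φ.Sat A a} - L.strProb n {A | typeOf Set.univ A a ∈ T}|
        ≤ Real.exp (-(c2 * n)) := by
      refine (abs_netProb_sub_le_of_symmDiff (L.nodeProb_nonneg n) (L.nodeProb_le_one n)
        fun ω hω => ?_).trans h2
      by_contra hne
      exact hω fun h => hne (h a)
    rw [← hd] at e2
    have b1 : Real.exp (-(c1 * n)) ≤ Real.exp (-(min c1 c2 * n)) := by
      gcongr; exact min_le_left _ _
    have b2 : Real.exp (-(c2 * n)) ≤ Real.exp (-(min c1 c2 * n)) := by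
      gcongr; exact min_le_right _ _
    have := abs_sub_le (G.prob n {A | φ.Sat A a}) (L.strProb n {A | φ.Sat A a})
      (∑ p ∈ W (Setoid.ker a), L.typeProb p)
    simp only [pow_zero, mul_one] at h3
    linarith

end LiftedBayesNet

/-- Convergence for noncritical formulas. A limit `d E` is given for every pattern `E` of equalities among
the entries of the tuple `a`; `Setoid.ker a` is the pattern of `a`. -/
theorem mainTheorem2 {σ : Type*} [Fintype σ] (ar : σ → ℕ) (har : ∀ R, 0 < ar R)
    (G : LiftedBayesNet ar)
    (hG : ∀ (R : σ) (i : Fin (G.num R)), G.Noncritical (G.ancestors R) (G.agg R i)) :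
    (∀ (k : ℕ) (φ : CPL ar k), G.Noncritical Set.univ φ →
      ∃ c > 0, ∃ d : Setoid (Fin k) → ℝ,
        (∀ E, 0 ≤ d E ∧ d E ≤ 1 ∧ ∃ l : ℕ, 0 < l ∧ G.IsCritical Set.univ l (d E)) ∧
        ∀ m : ℕ, 0 < m → ∀ a : Fin k → Fin m, ∀ᶠ n : ℕ in atTop, ∀ h : m ≤ n,
          |G.prob n {A | φ.Sat A (fun i => Fin.castLE h (a i))} - d (Setoid.ker a)|
            ≤ Real.exp (-(c * n))) ∧
    (∀ φ : CPL ar 0, G.Noncritical Set.univ φ →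
      Tendsto (fun n : ℕ => G.prob n {A | φ.Sat A Fin.elim0}) atTop (𝓝 0) ∨
      Tendsto (fun n : ℕ => G.prob n {A | φ.Sat A Fin.elim0}) atTop (𝓝 1)) := by
  constructor
  · intro k φ hφ
    obtain ⟨c, hc, d, hd, h⟩ := LiftedBayesNet.exists_limit har hG φ hφ
    refine ⟨c, hc, d, fun E => ⟨(hd E).1, (hd E).2.1, (hd E).2.2.1⟩, fun m _ a => ?_⟩
    filter_upwards [h] with n hn hmn
    have hker : Setoid.ker (fun i => Fin.castLE hmn (a i)) = Setoid.ker a := by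
      ext i j
      simp only [Setoid.ker_def, Fin.castLE_inj]
    rw [← hker]
    exact hn _
  · intro φ hφ
    obtain ⟨c, hc, d, hd, h⟩ := LiftedBayesNet.exists_limit har hG φ hφ
    have hlim : Tendsto (fun n : ℕ => Real.exp (-(c * n))) atTop (𝓝 0) :=
      Real.tendsto_exp_neg_atTop_nhds_zero.comp (tendsto_natCast_atTop_atTop.const_mul_atTop hc)
    have hconv : Tendsto (fun n : ℕ => G.prob n {A | φ.Sat A Fin.elim0}) atTop (𝓝 (d ⊤)) := by
      rw [tendsto_iff_dist_tendsto_zero]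
      refine squeeze_zero' (Eventually.of_forall fun n => dist_nonneg) ?_ hlim
      filter_upwards [h] with n hn
      rw [Real.dist_eq]
      have hker : Setoid.ker (Fin.elim0 : Fin 0 → Fin n) = ⊤ := by
        ext i
        exact i.elim0
      rw [← hker]
      exact hn _
    rcases (hd ⊤).2.2.2 rfl with h0 | h0
    · exact Or.inl (h0 ▸ hconv)
    · exact Or.inr (h0 ▸ hconv)
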